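/- Let $p,m,n\ge 0$ be integers and, for $l=1,\dots,p$, let $A_l=(a^{(l)}_{i,k})\in[0,1]^{m\times m}$ and $B_l=(b^{(l)}_{j,k})\in[0,1]^{n\times n}$. For $Y\in\mathbb N_0^{m\times n}$, $A\in[0,1]^{m\times m}$ and $C\in[0,1]^{n\times n}$ define the left and right matricial binomial thinnings by $$(A\circ_L Y)_{i,j}=\sum_{k=1}^m a_{i,k}\circ y_{k,j},\qquad (Y\circ_R C)_{i,j}=\sum_{k=1}^n c_{k,j}\circ y_{i,k},$$ where each $q\circ y=\sum_{s=1}^{y}X_s$ is a binomial thinning, computed from its own counting series $(X_s)_{s\ge1}$ of i.i.d. Bernoulli$(q)$ variables. On a probability space let $(\mathcal E_t)_{t\in\mathbb Z}$ be i.i.d. $\mathbb N_0^{m\times n}$-valued innovations whose entries have finite second moments, with mean matrix $\Lambda$, and let a counting series be given for each time $t$, each lag $l$ and each scalar thinning $a^{(l)}_{i,k}\circ\cdot$ and $b^{(l)}_{j,k}\circ\cdot$ that occurs in $(A_l\circ_L\cdot)\circ_R B_l^{\top}$, all counting variables and innovations being mutually independent. Call the innovation and the counting variables of time $t$ the noise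 at time $t$. A MAT-INAR($p$) process driven by this noise is an $\mathbb N_0^{m\times n}$-valued process $(Y_t)_{t\in\mathbb Z}$ such that for every $t\in\mathbb Z$, almost surely, $$Y_t=\sum_{l=1}^p (A_l\circ_L Y_{t-l})\circ_R B_l^{\top}+\mathcal E_t ,$$ and the noise at time $t$ is independent of $(Y_{t-s})_{s\ge1}$. Let $\mathcal A$ be the $mnp\times mnp$ block matrix with $mn\times mn$ blocks $\mathcal A_{1,j}=B_j\otimes A_j$ ($1\le j\le p$), $\mathcal A_{i,i-1}=I_{mn}$ ($2\le i\le p$), and $0$ otherwise. If the spectral radius of $\mathcal A$ (the maximum modulus of its complex eigenvalues) is less than $1$, then there exists a MAT-INAR($p$) process $(Y_t)$ driven by the given noise that is strictly stationary and ergodic, has finite second moments (so that it is also second-order stationary), and is causal: there is one measurable function $f$ such that for every $t$, almost surely, $Y_t$ is $f$ of the noise at the times $t,t-1,t-2,\dots$. -/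

import Mathlib

open MeasureTheory ProbabilityTheory
open scoped Kronecker

/-- Binomial thinning `q ∘ y` computed from a realisation `c` of the counting series of `q`:
the sum of the first `y` counting variables (so it is `0` when `y = 0`). -/
def binThin (c : ℕ → ℕ) (y : ℕ) : ℕ := ∑ s ∈ Finset.range y, c s

/-- Left-matricial thinning `A ∘_L Y`, with entries `∑ k, a_{i,k} ∘ y_{k,j}`.
`c i k j` is the realised counting series used in `a_{i,k} ∘ y_{k,j}`. -/
def leftThin {m n : ℕ} (c : Fin m → Fin m → Fin n → ℕ → ℕ) (Y : Matrix (Fin m) (Fin n) ℕ) :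
    Matrix (Fin m) (Fin n) ℕ :=
  Matrix.of fun i j => ∑ k, binThin (c i k j) (Y k j)

/-- Right-matricial thinning `Y ∘_R C`, with entries `∑ k, c_{k,j} ∘ y_{i,k}`.
`d i k j` is the realised counting series used in `c_{k,j} ∘ y_{i,k}`. -/
def rightThin {m n : ℕ} (d : Fin m → Fin n → Fin n → ℕ → ℕ) (Y : Matrix (Fin m) (Fin n) ℕ) :
    Matrix (Fin m) (Fin n) ℕ :=
  Matrix.of fun i j => ∑ k, binThin (d i k j) (Y i k)

/-- Realisations of all counting series of the left thinnings at one time: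
indexed by the lag `l`, then `i k j` as in `leftThin`, then the position `s` in the series. -/
abbrev LeftCounts (p m n : ℕ) : Type := Fin p × Fin m × Fin m × Fin n × ℕ → ℕ

/-- Realisations of all counting series of the right thinnings at one time:
indexed by the lag `l`, then `i k j` as in `rightThin`, then the position `s` in the series. -/
abbrev RightCounts (p m n : ℕ) : Type := Fin p × Fin m × Fin n × Fin n × ℕ → ℕ

/-- Everything random that enters at one time: the innovation and the counting series. -/
abbrev Noise (p m n : ℕ) : Type :=
  (Fin m → Fin n → ℕ) × LeftCounts p m n × RightCounts p m n

/-- `X` is a Bernoulli variable with `P(X = 1) = q = 1 - P(X = 0)`. -/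
def IsBernoulli {Ω : Type*} [MeasurableSpace Ω] (X : Ω → ℕ) (q : ℝ) (μ : Measure Ω) : Prop :=
  μ.real {ω | X ω = 1} = q ∧ μ.real {ω | X ω = 0} = 1 - q

/-- The noise at time `t`. -/
def noiseAt {Ω : Type*} {p m n : ℕ} (E : ℤ → Ω → Matrix (Fin m) (Fin n) ℕ)
    (L : ℤ → Ω → LeftCounts p m n) (R : ℤ → Ω → RightCounts p m n) (t : ℤ) (ω : Ω) :
    Noise p m n :=
  (fun i j => E t ω i j, L t ω, R t ω)

/-- The assumptions on the innovations `E t` and on the counting series of the thinnings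
`A l ∘_L ·` (realised by `L t · (l, …)`) and `· ∘_R (B l)ᵀ` (realised by `R t · (l, …)`). -/
structure IsMatInarNoise {Ω : Type*} [MeasurableSpace Ω] {p m n : ℕ}
    (A : Fin p → Matrix (Fin m) (Fin m) ℝ) (B : Fin p → Matrix (Fin n) (Fin n) ℝ)
    (Lam : Matrix (Fin m) (Fin n) ℝ)
    (E : ℤ → Ω → Matrix (Fin m) (Fin n) ℕ) (L : ℤ → Ω → LeftCounts p m n)
    (R : ℤ → Ω → RightCounts p m n) (μ : Measure Ω) : Prop where
  /-- All the variables are random variables. -/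
  measurable (t : ℤ) : Measurable (noiseAt E L R t)
  /-- The counting variables of `a_{i,k}` are Bernoulli with parameter `a_{i,k}`. -/
  left_bernoulli (t : ℤ) (l : Fin p) (i k : Fin m) (j : Fin n) (s : ℕ) :
    IsBernoulli (fun ω => L t ω (l, i, k, j, s)) (A l i k) μ
  /-- The counting variables of the entries of `(B l)ᵀ` are Bernoulli with these parameters. -/
  right_bernoulli (t : ℤ) (l : Fin p) (i : Fin m) (k j : Fin n) (s : ℕ) :
    IsBernoulli (fun ω => R t ω (l, i, k, j, s)) ((B l).transpose k j) μ
  /-- At each time, all the counting variables are mutually independent. -/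
  indep_counts (t : ℤ) :
    iIndepFun (Sum.elim
      (fun (x : Fin p × Fin m × Fin m × Fin n × ℕ) (ω : Ω) => L t ω x)
      (fun (x : Fin p × Fin m × Fin n × Fin n × ℕ) (ω : Ω) => R t ω x)) μ
  /-- At each time, the innovation is independent of the counting series. -/
  indep_innov_counts (t : ℤ) :
    IndepFun (fun ω (i : Fin m) (j : Fin n) => E t ω i j) (fun ω => (L t ω, R t ω)) μ
  /-- The noises at different times are mutually independent. -/
  indep_time : iIndepFun (noiseAt E L R) μ
  /-- The innovations are identically distributed. -/
  innov_ident (t : ℤ) :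
    IdentDistrib (fun ω (i : Fin m) (j : Fin n) => E t ω i j)
      (fun ω (i : Fin m) (j : Fin n) => E 0 ω i j) μ μ
  /-- The innovations have finite second moments. -/
  innov_memLp (t : ℤ) (i : Fin m) (j : Fin n) : MemLp (fun ω => (E t ω i j : ℝ)) 2 μ
  /-- The innovations have mean matrix `Lam`. -/
  innov_mean (t : ℤ) (i : Fin m) (j : Fin n) : ∫ ω, (E t ω i j : ℝ) ∂μ = Lam i j

/-- `Y` is a MAT-INAR(p) process driven by the given noise. Lag `l + 1` is indexed by
`l : Fin p`. -/
structure IsMatInar {Ω : Type*} [MeasurableSpace Ω] {p m n : ℕ}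
    (E : ℤ → Ω → Matrix (Fin m) (Fin n) ℕ) (L : ℤ → Ω → LeftCounts p m n)
    (R : ℤ → Ω → RightCounts p m n) (Y : ℤ → Ω → Matrix (Fin m) (Fin n) ℕ)
    (μ : Measure Ω) : Prop where
  measurable (t : ℤ) : Measurable fun ω (i : Fin m) (j : Fin n) => Y t ω i j
  /-- `Y_t = ∑ l, A_l ∘_L Y_{t-l} ∘_R B_lᵀ + E_t`. -/
  recursion (t : ℤ) : ∀ᵐ ω ∂μ,
    Y t ω = (∑ l : Fin p,
      rightThin (fun i k j s => R t ω (l, i, k, j, s))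
        (leftThin (fun i k j s => L t ω (l, i, k, j, s)) (Y (t - ((l : ℤ) + 1)) ω))) + E t ω
  /-- The innovation and the counting series at time `t` are independent of the past of `Y`. -/
  indep_past (t : ℤ) :
    IndepFun (noiseAt E L R t)
      (fun ω (s : ℕ) (i : Fin m) (j : Fin n) => Y (t - ((s : ℤ) + 1)) ω i j) μ

/-- The sample path of `Y` at `ω`. -/
def samplePath {Ω : Type*} {m n : ℕ} (Y : ℤ → Ω → Matrix (Fin m) (Fin n) ℕ) (ω : Ω) :
    ℤ → Fin m → Fin n → ℕ :=
  fun t i j => Y t ω i j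

/-- Shift of a path by `h` units of time. -/
def shiftPath {S : Type*} (h : ℤ) (y : ℤ → S) : ℤ → S := fun t => y (t + h)

/-- Strict stationarity: the law of the path does not change under shifts of time. -/
def IsStrictlyStationary {Ω : Type*} [MeasurableSpace Ω] {m n : ℕ}
    (Y : ℤ → Ω → Matrix (Fin m) (Fin n) ℕ) (μ : Measure Ω) : Prop :=
  ∀ h : ℤ, μ.map (fun ω => shiftPath h (samplePath Y ω)) = μ.map (samplePath Y)

/-- Ergodicity: the shift is ergodic for the law of the path. -/
def IsErgodicProcess {Ω : Type*} [MeasurableSpace Ω] {m n : ℕ}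
    (Y : ℤ → Ω → Matrix (Fin m) (Fin n) ℕ) (μ : Measure Ω) : Prop :=
  Ergodic (shiftPath 1) (μ.map (samplePath Y))

/-- Causality: `Y_t` is one and the same measurable function, for every `t`, of the noise at
the times `t, t - 1, t - 2, …`. -/
def IsCausal {Ω : Type*} [MeasurableSpace Ω] {p m n : ℕ}
    (E : ℤ → Ω → Matrix (Fin m) (Fin n) ℕ) (L : ℤ → Ω → LeftCounts p m n)
    (R : ℤ → Ω → RightCounts p m n) (Y : ℤ → Ω → Matrix (Fin m) (Fin n) ℕ)
    (μ : Measure Ω) : Prop :=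
  ∃ f : (ℕ → Noise p m n) → (Fin m → Fin n → ℕ), Measurable f ∧
    ∀ t : ℤ, ∀ᵐ ω ∂μ, (fun i j => Y t ω i j) = f fun k : ℕ => noiseAt E L R (t - k) ω

/-- The companion block matrix: first block row `B_1 ⊗ A_1, …, B_p ⊗ A_p`, identity blocks
below the diagonal, zero blocks elsewhere. -/
def companionMatrix {p m n : ℕ} (A : Fin p → Matrix (Fin m) (Fin m) ℝ)
    (B : Fin p → Matrix (Fin n) (Fin n) ℝ) :
    Matrix (Fin p × (Fin n × Fin m)) (Fin p × (Fin n × Fin m)) ℝ :=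
  Matrix.of fun x y =>
    if (x.1 : ℕ) = 0 then (B y.1 ⊗ₖ A y.1) x.2 y.2
    else if (x.1 : ℕ) = (y.1 : ℕ) + 1 then (1 : Matrix (Fin n × Fin m) (Fin n × Fin m) ℝ) x.2 y.2
    else 0

/-!
The solution is built by Picard iteration. Let `matInarIter K` be the `K`-th iterate of the
right-hand side of the recursion, applied to the zero path, as a function of the noise at the
present and past times. Thinning and addition are monotone in the counts, so these states increase
in `K`, and `matInarLimit` is their supremum. `Y t` is this function of the noise at the times `t,
t - 1, …`, which gives causality, and independence of the noise at time `t` from the past of `Y`.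

The moments of the iterates are bounded uniformly in `K`. The entries of the thinnings at lag `l`
have means given by the nonnegative matrix `B l ⊗ A l`. The spectral radius condition makes the
Neumann series of the companion matrix converge, and its fixed point has equal blocks, which
yields a nonnegative vector `u = 1 + ∑ l, (B l ⊗ A l) u` (`exists_subinvariant_weight`). A
multiple of `u` dominates every nonnegative sequence that starts from `0` and satisfies the
recursive inequality with bounded source (`le_mul_weight_of_recursion`). This applies to the
means. It also applies to the `L²` norms: by Minkowski's inequality, thinning by `q` multiplies
the `L²` norm by at most `q`, plus the square root of the mean (`eLpNorm_binThin_le`), and the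
means are already bounded. Hence the suprema are almost surely finite, so that the iterates are
eventually constant and their limit solves the recursion, and the limit has finite second moments.

Finally, the noises at different times are i.i.d., the shift on their path space is ergodic
(`ergodic_shiftPath_of_iid`), and the path of `Y` is the image of the noise path under a
measurable map that commutes with shifts. Stationarity and ergodicity pass to such images.
-/

/-! ### Powers of a matrix of spectral radius less than one -/

section CompanionSpectrum

open Filter Topology

/-- By Gelfand's formula the norms of the powers decay geometrically. -/
theorem summable_norm_pow_of_spectralRadius_lt_one {𝔸 : Type*} [NormedRing 𝔸] [NormedAlgebra ℂ 𝔸]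
    [CompleteSpace 𝔸] (a : 𝔸) (h : spectralRadius ℂ a < 1) : Summable fun k => ‖a ^ k‖ := by
  obtain ⟨r, hr, hr1⟩ := exists_between h
  have hlt := (spectrum.pow_nnnorm_pow_one_div_tendsto_nhds_spectralRadius a).eventually_lt_const hr
  have hrt : r ≠ ⊤ := (hr1.trans ENNReal.one_lt_top).ne
  lift r to NNReal using hrt
  have hr1' : (r : ℝ) < 1 := by exact_mod_cast hr1
  refine summable_of_isBigO_nat (summable_geometric_of_lt_one r.2 hr1') ?_
  refine Asymptotics.IsBigO.of_bound 1 ?_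
  filter_upwards [hlt, eventually_gt_atTop 0] with k hk hk0
  have hk0' : (0 : ℝ) < k := by exact_mod_cast hk0
  have h2 := ENNReal.rpow_le_rpow hk.le hk0'.le
  rw [← ENNReal.rpow_mul, one_div, inv_mul_cancel₀ hk0'.ne', ENNReal.rpow_one,
    ENNReal.rpow_natCast] at h2
  have h3 : ‖a ^ k‖₊ ≤ r ^ k := by exact_mod_cast h2
  rw [norm_norm, one_mul, Real.norm_of_nonneg (pow_nonneg r.2 k)]
  exact_mod_cast h3

attribute [local instance] Matrix.linftyOpNormedRing Matrix.linftyOpNormedAlgebra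
  Matrix.linftyOpNormedAddCommGroup Matrix.linftyOpNormedSpace in
theorem Matrix.summable_pow_of_spectralRadius_lt_one {ι : Type*} [Fintype ι] [DecidableEq ι]
    (M : Matrix ι ι ℝ) (h : spectralRadius ℂ (M.map (algebraMap ℝ ℂ)) < 1) (i j : ι) :
    Summable fun k => (M ^ k) i j := by
  have h1 := summable_norm_pow_of_spectralRadius_lt_one (M.map (algebraMap ℝ ℂ)) h
  have h2 : Summable fun k => (M.map (algebraMap ℝ ℂ)) ^ k := h1.of_norm
  have h3 : Summable fun k => ((M.map (algebraMap ℝ ℂ)) ^ k) i j :=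
    Pi.summable.1 (Pi.summable.1 h2 i) j
  have h4 : ∀ k, ((M.map (algebraMap ℝ ℂ)) ^ k) i j = (((M ^ k) i j : ℝ) : ℂ) := by
    intro k
    have : (M.map (algebraMap ℝ ℂ)) ^ k = (M ^ k).map (algebraMap ℝ ℂ) :=
      (map_pow (algebraMap ℝ ℂ).mapMatrix M k).symm
    rw [this]
    rfl
  simp only [h4] at h3
  exact Complex.summable_ofReal.1 h3

theorem Matrix.pow_nonneg_entry {ι : Type*} [Fintype ι] [DecidableEq ι] {M : Matrix ι ι ℝ}
    (hM : ∀ i j, 0 ≤ M i j) (k : ℕ) (i j : ι) : 0 ≤ (M ^ k) i j := by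
  induction k generalizing i j with
  | zero => rw [pow_zero, Matrix.one_apply]; split_ifs <;> norm_num
  | succ k ih =>
    rw [pow_succ, Matrix.mul_apply]
    exact Finset.sum_nonneg fun x _ => mul_nonneg (ih i x) (hM x j)

/-- The solution of `v = e + M v` is the Neumann series `∑ k, M ^ k e`, which is nonnegative when
`M` and `e` are. -/
theorem Matrix.exists_nonneg_fixed_point {ι : Type*} [Fintype ι] [DecidableEq ι]
    {M : Matrix ι ι ℝ} (hM : ∀ i j, 0 ≤ M i j)
    (h : spectralRadius ℂ (M.map (algebraMap ℝ ℂ)) < 1) {e : ι → ℝ} (he : ∀ i, 0 ≤ e i) :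
    ∃ v : ι → ℝ, (∀ i, 0 ≤ v i) ∧ ∀ i, v i = e i + ∑ j, M i j * v j := by
  have hs : ∀ i, Summable fun k => ((M ^ k).mulVec e) i := fun i => by
    simp only [Matrix.mulVec, dotProduct]
    exact summable_sum fun j _ =>
      (Matrix.summable_pow_of_spectralRadius_lt_one M h i j).mul_right (e j)
  refine ⟨fun i => ∑' k, ((M ^ k).mulVec e) i, fun i => tsum_nonneg fun k => ?_, fun i => ?_⟩
  · exact Finset.sum_nonneg fun j _ => mul_nonneg (Matrix.pow_nonneg_entry hM k i j) (he j)
  · beta_reduce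
    rw [(hs i).tsum_eq_zero_add]
    congr 1
    · simp
    · simp only [← tsum_mul_left]
      rw [← Summable.tsum_finsetSum fun j _ => (hs j).mul_left _]
      refine tsum_congr fun k => ?_
      rw [pow_succ', ← Matrix.mulVec_mulVec]
      rfl

/-- The fixed point of the companion matrix with source `1` in the first block is the same vector
`u` in every block, since the lower block rows copy each block to the next one. Thus `u` solves
`u = 1 + ∑ l, (B l ⊗ A l) u`, where the lags are summed without delay. -/
theorem exists_subinvariant_weight {p m n : ℕ} {A : Fin p → Matrix (Fin m) (Fin m) ℝ}
    {B : Fin p → Matrix (Fin n) (Fin n) ℝ}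
    (hA : ∀ l i j, 0 ≤ A l i j) (hB : ∀ l i j, 0 ≤ B l i j)
    (hρ : spectralRadius ℂ ((companionMatrix A B).map (algebraMap ℝ ℂ)) < 1) :
    ∃ u : Fin m → Fin n → ℝ, (∀ i j, 0 ≤ u i j) ∧
      ∀ i j, u i j = 1 + ∑ l, ∑ k, ∑ k', B l j k * A l i k' * u k' k := by
  rcases p with _ | p
  · exact ⟨fun _ _ => 1, fun _ _ => zero_le_one, fun i j => by simp⟩
  have hnn : ∀ x y, 0 ≤ companionMatrix A B x y := by
    intro x y
    simp only [companionMatrix, Matrix.of_apply, Matrix.kroneckerMap_apply]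
    split_ifs
    · exact mul_nonneg (hB _ _ _) (hA _ _ _)
    · rw [Matrix.one_apply]; split_ifs <;> norm_num
    · exact le_rfl
  obtain ⟨v, hv, hfix⟩ := Matrix.exists_nonneg_fixed_point hnn hρ
    (e := fun x => if x.1 = 0 then 1 else 0) (fun x => by split_ifs <;> norm_num)
  have hstep : ∀ (l : ℕ) (hl : l + 1 < p + 1) (x : Fin n × Fin m),
      v (⟨l + 1, hl⟩, x) = v (⟨l, by omega⟩, x) := by
    intro l hl x
    rw [hfix, Fintype.sum_eq_single ((⟨l, by omega⟩ : Fin (p + 1)), x)]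
    · have h0 : (⟨l + 1, hl⟩ : Fin (p + 1)) ≠ 0 := fun h => by simpa using congrArg Fin.val h
      have h1 : companionMatrix A B (⟨l + 1, hl⟩, x) (⟨l, by omega⟩, x) = 1 := by
        simp [companionMatrix]
      rw [h1, one_mul, if_neg h0, zero_add]
    · rintro ⟨l', x'⟩ hne
      simp only [companionMatrix, Matrix.of_apply, Nat.add_eq_zero_iff, one_ne_zero, and_false,
        if_false, add_left_inj]
      split_ifs with h1
      · have : x ≠ x' := by
          rintro rfl
          exact hne (by simp [h1])
        rw [Matrix.one_apply_ne this, zero_mul]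
      · rw [zero_mul]
  have hconst : ∀ (l : ℕ) (hl : l < p + 1) (x : Fin n × Fin m), v (⟨l, hl⟩, x) = v (0, x) := by
    intro l
    induction l with
    | zero => intro hl x; rfl
    | succ l ih => intro hl x; rw [hstep, ih]
  refine ⟨fun i j => v (0, (j, i)), fun i j => hv _, fun i j => ?_⟩
  simp only
  rw [hfix, Fintype.sum_prod_type]
  simp only [if_true]
  congr 1
  refine Finset.sum_congr rfl fun l _ => ?_
  rw [Fintype.sum_prod_type]
  refine Finset.sum_congr rfl fun k _ => Finset.sum_congr rfl fun k' _ => ?_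
  rw [hconst l l.2]
  simp [companionMatrix]

end CompanionSpectrum

/-! ### Independent subfamilies and ergodicity of the shift of an i.i.d. sequence -/

section IndependenceAndErgodicity

open Filter Topology

theorem comap_reindex_le {Ω ι γ S : Type*} [MeasurableSpace S] (X : ι → Ω → S) (c : γ → ι) :
    MeasurableSpace.comap (fun ω x => X (c x) ω) MeasurableSpace.pi
      ≤ ⨆ i ∈ Set.range c, MeasurableSpace.comap (X i) inferInstance := by
  simp only [MeasurableSpace.pi, MeasurableSpace.comap_iSup, MeasurableSpace.comap_comp]
  exact iSup_le fun x => le_iSup₂_of_le (c x) ⟨x, rfl⟩ le_rfl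

/-- Two subfamilies, possibly infinite, of an independent family are independent if they have no
index in common. -/
theorem indepFun_reindex_of_iIndepFun {Ω ι α β S : Type*} [MeasurableSpace Ω] [MeasurableSpace S]
    {μ : Measure Ω} {X : ι → Ω → S} (hX : ∀ i, Measurable (X i)) (hind : iIndepFun X μ)
    (a : α → ι) (b : β → ι) (hab : ∀ x y, a x ≠ b y) :
    IndepFun (fun ω x => X (a x) ω) (fun ω y => X (b y) ω) μ := by
  have hdisj : Disjoint (Set.range a) (Set.range b) := by
    rw [Set.disjoint_left]
    rintro _ ⟨x, rfl⟩ ⟨y, hy⟩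
    exact hab x y hy.symm
  have h := indep_iSup_of_disjoint (fun i => (hX i).comap_le) hind hdisj
  exact indep_of_indep_of_le_left (indep_of_indep_of_le_right h (comap_reindex_le X b))
    (comap_reindex_le X a)

/-- Asymptotic independence from a sequence of events `C k` extends from a π-system to the
σ-algebra it generates: the sets `A` for which `P (A ∩ C k) → P A * b` form a Dynkin system. -/
theorem tendsto_measureReal_inter_of_isPiSystem {α : Type*} [m : MeasurableSpace α]
    (P : Measure α) [IsProbabilityMeasure P] {π : Set (Set α)}
    (hgen : m = MeasurableSpace.generateFrom π) (hπ : IsPiSystem π)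
    {C : ℕ → Set α} (hC : ∀ k, MeasurableSet (C k)) {b : ℝ}
    (hb : Tendsto (fun k => P.real (C k)) atTop (𝓝 b))
    (h : ∀ A ∈ π, Tendsto (fun k => P.real (A ∩ C k)) atTop (𝓝 (P.real A * b)))
    {A : Set α} (hA : MeasurableSet A) :
    Tendsto (fun k => P.real (A ∩ C k)) atTop (𝓝 (P.real A * b)) := by
  induction A, hA using MeasurableSpace.induction_on_inter hgen hπ with
  | empty => simp
  | basic A hA => exact h A hA
  | compl A hA ih =>
    have h1 : ∀ k, P.real (Aᶜ ∩ C k) = P.real (C k) - P.real (A ∩ C k) := by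
      intro k
      have := measureReal_inter_add_sdiff (μ := P) (s := C k) (t := A) hA
      rw [Set.inter_comm Aᶜ, ← Set.sdiff_eq, Set.inter_comm A]
      linarith
    simp only [h1, probReal_compl_eq_one_sub hA, sub_mul, one_mul]
    exact hb.sub ih
  | iUnion A hd hA ih =>
    have h1 : ∀ D, MeasurableSet D →
        HasSum (fun i => P.real (A i ∩ D)) (P.real ((⋃ i, A i) ∩ D)) := by
      intro D hD
      rw [Set.iUnion_inter]
      have hdis : Pairwise (Function.onFun Disjoint fun i => A i ∩ D) := fun i j hij =>
        (hd hij).mono Set.inter_subset_left Set.inter_subset_left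
      have hm : ∀ i, MeasurableSet (A i ∩ D) := fun i => (hA i).inter hD
      have h2 := measure_iUnion (μ := P) hdis hm
      have hfin : ∑' i, P (A i ∩ D) ≠ ⊤ := by
        rw [← h2]; exact measure_ne_top _ _
      rw [measureReal_def, h2, ENNReal.tsum_toReal_eq (fun i => measure_ne_top _ _)]
      exact (ENNReal.summable_toReal hfin).hasSum
    have hU := h1 Set.univ MeasurableSet.univ
    simp only [Set.inter_univ] at hU
    rw [← (hU.mul_right b).tsum_eq]
    have h3 : ∀ k, P.real ((⋃ i, A i) ∩ C k) = ∑' i, P.real (A i ∩ C k) := fun k =>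
      (h1 (C k) (hC k)).tsum_eq.symm
    simp only [h3]
    refine tendsto_tsum_of_dominated_convergence hU.summable ih ?_
    filter_upwards with k i
    rw [Real.norm_of_nonneg measureReal_nonneg]
    exact measureReal_mono Set.inter_subset_left

theorem measurable_shiftPath {S : Type*} [MeasurableSpace S] (h : ℤ) :
    Measurable (shiftPath (S := S) h) := by
  unfold shiftPath
  fun_prop

theorem shiftPath_one_iterate {S : Type*} (k : ℕ) :
    (shiftPath (S := S) 1)^[k] = shiftPath (k : ℤ) := by
  induction k with
  | zero => ext y t; simp [shiftPath]
  | succ k ih =>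
    rw [Function.iterate_succ', ih]
    ext y t
    simp only [Function.comp, shiftPath]
    congr 1
    push_cast
    ring

section IID

variable {Ω S : Type*} [MeasurableSpace Ω] [MeasurableSpace S] {μ : Measure Ω}
  {X : ℤ → Ω → S}

theorem map_shiftPath_of_iid (hX : ∀ t, Measurable (X t)) (hind : iIndepFun X μ)
    (hid : ∀ t, μ.map (X t) = μ.map (X 0)) (h : ℤ) :
    μ.map (fun ω => shiftPath h fun t => X t ω) = μ.map (fun ω t => X t ω) := by
  have h1 : iIndepFun (fun t => X (t + h)) μ := hind.precomp (add_left_injective h)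
  have h2 := h1.map_fun_eq_infinitePi_map (fun t => hX _)
  have h3 := hind.map_fun_eq_infinitePi_map hX
  unfold shiftPath
  rw [h2, h3]
  simp only [hid]

theorem measurePreserving_shiftPath_of_iid (hX : ∀ t, Measurable (X t)) (hind : iIndepFun X μ)
    (hid : ∀ t, μ.map (X t) = μ.map (X 0)) (h : ℤ) :
    MeasurePreserving (shiftPath h) (μ.map (fun ω t => X t ω)) (μ.map (fun ω t => X t ω)) := by
  refine ⟨measurable_shiftPath h, ?_⟩
  rw [Measure.map_map (measurable_shiftPath h) (measurable_pi_lambda _ hX)]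
  exact map_shiftPath_of_iid hX hind hid h

/-- A cylinder and a far enough shift of another cylinder depend on disjoint sets of coordinates,
so they are independent under the law of an i.i.d. sequence. -/
theorem eventually_measureReal_inter_shiftPath_of_iid (hX : ∀ t, Measurable (X t))
    (hind : iIndepFun X μ) (hid : ∀ t, μ.map (X t) = μ.map (X 0)) {A B : Set (ℤ → S)}
    (hA : A ∈ measurableCylinders fun _ : ℤ => S) (hB : B ∈ measurableCylinders fun _ : ℤ => S) :
    ∀ᶠ k : ℕ in atTop,
      (μ.map (fun ω t => X t ω)).real (A ∩ shiftPath (k : ℤ) ⁻¹' B) =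
        (μ.map (fun ω t => X t ω)).real A * (μ.map (fun ω t => X t ω)).real B := by
  have hmA := MeasurableSet.of_mem_measurableCylinders hA
  have hmB := MeasurableSet.of_mem_measurableCylinders hB
  have hpath : Measurable fun ω t => X t ω := measurable_pi_lambda _ hX
  obtain ⟨s, U, hU, rfl⟩ := (mem_measurableCylinders _).1 hA
  obtain ⟨s', U', hU', rfl⟩ := (mem_measurableCylinders _).1 hB
  -- From `M` on, the shift separates the two finite sets of coordinates.
  obtain ⟨M, hM⟩ : ∃ M : ℕ, ∀ x ∈ s, ∀ y ∈ s', x - y < M := by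
    refine ⟨(∑ x ∈ s, ∑ y ∈ s', (x - y).natAbs) + 1, fun x hx y hy => ?_⟩
    have h1 : (x - y).natAbs ≤ ∑ x ∈ s, ∑ y ∈ s', (x - y).natAbs :=
      (Finset.single_le_sum (f := fun y => (x - y).natAbs) (fun _ _ => Nat.zero_le _) hy).trans
        (Finset.single_le_sum (f := fun x => ∑ y ∈ s', (x - y).natAbs)
          (fun _ _ => Nat.zero_le _) hx)
    have h2 : x - y ≤ (x - y).natAbs := Int.le_natAbs
    omega
  filter_upwards [eventually_ge_atTop M] with k hk
  have hI := indepFun_reindex_of_iIndepFun hX hind (fun x : s => (x : ℤ))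
    (fun y : s' => (y : ℤ) + k) (fun x y h => by
      have := hM x x.2 y y.2
      omega)
  have hkey := hI.measure_inter_preimage_eq_mul U U' hU hU'
  have hinv := (measurePreserving_shiftPath_of_iid hX hind hid k).measure_preimage
    hmB.nullMeasurableSet
  rw [Measure.map_apply hpath (measurable_shiftPath _ hmB)] at hinv
  rw [measureReal_def, measureReal_def, measureReal_def, ← ENNReal.toReal_mul, ← hinv,
    Measure.map_apply hpath hmA, Measure.map_apply hpath (hmA.inter (measurable_shiftPath _ hmB))]
  exact congrArg ENNReal.toReal hkey

/-- The shift is ergodic for the law of an i.i.d. sequence. An invariant event `D` is asymptotically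
independent of the shifts of a cylinder `B`; by invariance `P (D ∩ B)` does not change under these
shifts, so `D` is independent of `B`, hence of every event, hence of itself. -/
theorem ergodic_shiftPath_of_iid [IsProbabilityMeasure μ] (hX : ∀ t, Measurable (X t))
    (hind : iIndepFun X μ)
    (hid : ∀ t, μ.map (X t) = μ.map (X 0)) :
    Ergodic (shiftPath 1) (μ.map (fun ω t => X t ω)) := by
  set P := μ.map (fun ω t => X t ω) with hP
  have hpath : Measurable fun ω t => X t ω := measurable_pi_lambda _ hX
  have : IsProbabilityMeasure P := Measure.isProbabilityMeasure_map hpath.aemeasurable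
  have hpres := measurePreserving_shiftPath_of_iid hX hind hid
  refine ⟨hpres 1, ⟨fun D hD hinv => ?_⟩⟩
  have hinv' : ∀ k : ℕ, shiftPath (k : ℤ) ⁻¹' D = D := by
    intro k
    rw [← shiftPath_one_iterate, congrFun Set.preimage_iterate_eq D]
    exact Function.IsFixedPt.iterate (f := Set.preimage (shiftPath 1)) hinv k
  have hcyl : ∀ B ∈ measurableCylinders fun _ : ℤ => S,
      P.real (B ∩ D) = P.real B * P.real D := by
    intro B hB
    have hmB := MeasurableSet.of_mem_measurableCylinders hB
    have hC : ∀ k : ℕ, P.real (shiftPath (k : ℤ) ⁻¹' B) = P.real B := fun k =>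
      (hpres k).measureReal_preimage hmB.nullMeasurableSet
    have hlim := tendsto_measureReal_inter_of_isPiSystem P generateFrom_measurableCylinders.symm
      isPiSystem_measurableCylinders (C := fun k : ℕ => shiftPath (k : ℤ) ⁻¹' B)
      (fun k => measurable_shiftPath _ hmB) (b := P.real B)
      (by simp only [hC]; exact tendsto_const_nhds)
      (fun A hA => tendsto_const_nhds.congr' (by
        filter_upwards [eventually_measureReal_inter_shiftPath_of_iid hX hind hid hA hB] with k hk
        exact hk.symm)) hD
    have hconst : ∀ k : ℕ, P.real (D ∩ shiftPath (k : ℤ) ⁻¹' B) = P.real (D ∩ B) := by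
      intro k
      rw [← (hpres k).measureReal_preimage (hD.inter hmB).nullMeasurableSet, Set.preimage_inter,
        hinv' k]
    simp only [hconst] at hlim
    rw [Set.inter_comm, tendsto_nhds_unique tendsto_const_nhds hlim, mul_comm]
  have hDD := tendsto_measureReal_inter_of_isPiSystem P generateFrom_measurableCylinders.symm
      isPiSystem_measurableCylinders (C := fun _ : ℕ => D)
      (fun _ => hD) tendsto_const_nhds
      (fun B hB => by simp only [hcyl B hB]; exact tendsto_const_nhds) hD
  have hsq := tendsto_nhds_unique tendsto_const_nhds hDD
  rw [Set.inter_self] at hsq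
  have : P.real D = 0 ∨ P.real D = 1 := by
    rcases eq_or_ne (P.real D) 0 with h0 | h0
    · exact Or.inl h0
    · exact Or.inr (mul_left_cancel₀ h0 (by rw [mul_one]; exact hsq.symm))
  rw [Filter.eventuallyConst_set']
  rcases this with h0 | h1
  · left
    rw [ae_eq_empty]
    exact (measureReal_eq_zero_iff).1 h0
  · right
    rw [ae_eq_univ]
    rw [measureReal_def, ENNReal.toReal_eq_one_iff] at h1
    exact (prob_compl_eq_zero_iff hD).2 h1

end IID

end IndependenceAndErgodicity

/-! ### The law of a Bernoulli variable -/

section BernoulliLaw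

variable {Ω : Type*} [MeasurableSpace Ω] {μ : Measure Ω} [IsProbabilityMeasure μ]

theorem IsBernoulli.map_eq {X : Ω → ℕ} {q : ℝ} (hX : Measurable X) (h : IsBernoulli X q μ) :
    μ.map X = ENNReal.ofReal q • Measure.dirac 1 + ENNReal.ofReal (1 - q) • Measure.dirac 0 := by
  obtain ⟨h1, h0⟩ := h
  have hm : ∀ k : ℕ, MeasurableSet {ω | X ω = k} := fun k => hX (measurableSet_singleton k)
  have e1 : μ {ω | X ω = 1} = ENNReal.ofReal q := by rw [← h1, ofReal_measureReal]
  have e0 : μ {ω | X ω = 0} = ENNReal.ofReal (1 - q) := by rw [← h0, ofReal_measureReal]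
  refine Measure.ext_of_singleton fun k => ?_
  rw [Measure.map_apply hX (measurableSet_singleton k)]
  have hk : X ⁻¹' {k} = {ω | X ω = k} := rfl
  rw [hk]
  rcases k with _ | _ | k
  · simp [e0]
  · simp [e1]
  · have hdis : Disjoint {ω | X ω = 1} {ω | X ω = 0} := by
      rw [Set.disjoint_left]
      intro ω (h1 : X ω = 1) (h2 : X ω = 0)
      omega
    have hu : μ.real ({ω | X ω = 1} ∪ {ω | X ω = 0}) = 1 := by
      rw [measureReal_union hdis (hm 0), h1, h0]
      ring
    have hc : μ ({ω | X ω = 1} ∪ {ω | X ω = 0})ᶜ = 0 := by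
      rw [prob_compl_eq_zero_iff ((hm 1).union (hm 0))]
      rwa [measureReal_def, ENNReal.toReal_eq_one_iff] at hu
    have : μ {ω | X ω = k + 1 + 1} = 0 := by
      refine measure_mono_null (fun ω (hω : X ω = k + 1 + 1) => ?_) hc
      simp [hω]
    simp [this]

theorem IsBernoulli.ae_le_one {X : Ω → ℕ} {q : ℝ} (hX : Measurable X) (h : IsBernoulli X q μ) :
    ∀ᵐ ω ∂μ, X ω ≤ 1 := by
  have h2 : μ (X ⁻¹' Set.Ioi 1) = 0 := by
    rw [← Measure.map_apply hX measurableSet_Ioi, h.map_eq hX]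
    simp
  filter_upwards [measure_eq_zero_iff_ae_notMem.1 h2] with ω hω
  simpa using hω

theorem IsBernoulli.lintegral_eq {X : Ω → ℕ} {q : ℝ} (hX : Measurable X)
    (h : IsBernoulli X q μ) : ∫⁻ ω, (X ω : ENNReal) ∂μ = ENNReal.ofReal q := by
  rw [← lintegral_map (f := fun k : ℕ => (k : ENNReal)) measurable_from_top hX, h.map_eq hX]
  simp

theorem IsBernoulli.memLp {X : Ω → ℕ} {q : ℝ} (hX : Measurable X)
    (h : IsBernoulli X q μ) : MemLp (fun ω => (X ω : ℝ)) 2 μ := by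
  refine MemLp.of_bound (measurable_from_top.comp hX).aestronglyMeasurable 1 ?_
  filter_upwards [h.ae_le_one hX] with ω hω
  simpa using hω

theorem IsBernoulli.integral_eq {X : Ω → ℕ} {q : ℝ} (hq : 0 ≤ q) (hX : Measurable X)
    (h : IsBernoulli X q μ) : ∫ ω, (X ω : ℝ) ∂μ = q := by
  rw [integral_eq_lintegral_of_nonneg_ae (f := fun ω => (X ω : ℝ))
    (by filter_upwards with ω; positivity)
    (measurable_from_top.comp hX : Measurable fun ω => (X ω : ℝ)).aestronglyMeasurable]
  simp only [ENNReal.ofReal_natCast, h.lintegral_eq hX, ENNReal.toReal_ofReal hq]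

theorem IsBernoulli.variance_le {X : Ω → ℕ} {q : ℝ} (hX : Measurable X)
    (h : IsBernoulli X q μ) : variance (fun ω => (X ω : ℝ)) μ ≤ 1 := by
  have := variance_le_sq_of_bounded (μ := μ) (X := fun ω => (X ω : ℝ)) (a := 0) (b := 1)
    (by
      filter_upwards [h.ae_le_one hX] with ω hω
      refine ⟨by positivity, by exact_mod_cast hω⟩)
    (measurable_from_top.comp hX).aemeasurable
  linarith

end BernoulliLaw

/-! ### The noises at all times have the same law -/

section NoiseLaw

variable {Ω : Type*} [MeasurableSpace Ω] {μ : Measure Ω} [IsProbabilityMeasure μ] {p m n : ℕ}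
  {A : Fin p → Matrix (Fin m) (Fin m) ℝ} {B : Fin p → Matrix (Fin n) (Fin n) ℝ}
  {Lam : Matrix (Fin m) (Fin n) ℝ}
  {E : ℤ → Ω → Matrix (Fin m) (Fin n) ℕ} {L : ℤ → Ω → LeftCounts p m n}
  {R : ℤ → Ω → RightCounts p m n}

omit [IsProbabilityMeasure μ] in
theorem IsMatInarNoise.measurable_innov (h : IsMatInarNoise A B Lam E L R μ) (t : ℤ) :
    Measurable fun ω (i : Fin m) (j : Fin n) => E t ω i j :=
  (h.measurable t).fst

omit [IsProbabilityMeasure μ] in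
theorem IsMatInarNoise.measurable_left (h : IsMatInarNoise A B Lam E L R μ) (t : ℤ) :
    Measurable (L t) :=
  (h.measurable t).snd.fst

omit [IsProbabilityMeasure μ] in
theorem IsMatInarNoise.measurable_right (h : IsMatInarNoise A B Lam E L R μ) (t : ℤ) :
    Measurable (R t) :=
  (h.measurable t).snd.snd

/-- The counting variables of one time are independent with prescribed Bernoulli laws, so their
joint law is a product measure that does not depend on the time. -/
theorem IsMatInarNoise.map_counts (h : IsMatInarNoise A B Lam E L R μ) (t : ℤ) :
    μ.map (fun ω => (L t ω, R t ω)) = μ.map (fun ω => (L 0 ω, R 0 ω)) := by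
  let X : ℤ → (Fin p × Fin m × Fin m × Fin n × ℕ) ⊕ (Fin p × Fin m × Fin n × Fin n × ℕ) →
      Ω → ℕ := fun t => Sum.elim (fun x ω => L t ω x) (fun x ω => R t ω x)
  have hX : ∀ t x, Measurable (X t x) := by
    rintro t (x | x)
    · exact (measurable_pi_apply x).comp (h.measurable_left t)
    · exact (measurable_pi_apply x).comp (h.measurable_right t)
  have hlaw : ∀ x, μ.map (X t x) = μ.map (X 0 x) := by
    rintro (⟨l, i, k, j, s⟩ | ⟨l, i, k, j, s⟩)
    · rw [(h.left_bernoulli t l i k j s).map_eq (hX t (Sum.inl _)),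
        (h.left_bernoulli 0 l i k j s).map_eq (hX 0 (Sum.inl _))]
    · rw [(h.right_bernoulli t l i k j s).map_eq (hX t (Sum.inr _)),
        (h.right_bernoulli 0 l i k j s).map_eq (hX 0 (Sum.inr _))]
  have hjoint : μ.map (fun ω x => X t x ω) = μ.map (fun ω x => X 0 x ω) := by
    rw [(h.indep_counts t).map_fun_eq_infinitePi_map (hX t),
      (h.indep_counts 0).map_fun_eq_infinitePi_map (hX 0)]
    exact congrArg Measure.infinitePi (funext hlaw)
  let G : ((Fin p × Fin m × Fin m × Fin n × ℕ) ⊕ (Fin p × Fin m × Fin n × Fin n × ℕ) → ℕ) →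
      LeftCounts p m n × RightCounts p m n := fun y => (fun x => y (.inl x), fun x => y (.inr x))
  have hG : Measurable G := by fun_prop
  have h2 := congrArg (Measure.map G) hjoint
  rwa [Measure.map_map hG (measurable_pi_lambda _ (hX t)),
    Measure.map_map hG (measurable_pi_lambda _ (hX 0))] at h2

theorem IsMatInarNoise.map_noiseAt (h : IsMatInarNoise A B Lam E L R μ) (t : ℤ) :
    μ.map (noiseAt E L R t) = μ.map (noiseAt E L R 0) := by
  have hc : ∀ t, Measurable fun ω => (L t ω, R t ω) := fun t =>
    (h.measurable_left t).prodMk (h.measurable_right t)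
  have e : ∀ t, μ.map (noiseAt E L R t) =
      (μ.map fun ω (i : Fin m) (j : Fin n) => E t ω i j).prod (μ.map fun ω => (L t ω, R t ω)) :=
    fun t => (indepFun_iff_map_prod_eq_prod_map_map (h.measurable_innov t).aemeasurable
      (hc t).aemeasurable).1 (h.indep_innov_counts t)
  rw [e, e, h.map_counts t, (h.innov_ident t).map_eq]

end NoiseLaw

/-! ### First and second moments of binomial thinnings -/

section ThinningMoments

variable {Ω : Type*} [MeasurableSpace Ω] {μ : Measure Ω} [IsProbabilityMeasure μ]

theorem indepFun_prodMk_right_of_indepFun {α β γ : Type*} [MeasurableSpace α] [MeasurableSpace β]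
    [MeasurableSpace γ] {f : Ω → α} {g : Ω → β} {h : Ω → γ} (hf : Measurable f)
    (hg : Measurable g) (hh : Measurable h) (hfg : IndepFun f g μ)
    (hfgh : IndepFun (fun ω => (f ω, g ω)) h μ) : IndepFun f (fun ω => (g ω, h ω)) μ := by
  have hgh : IndepFun g h μ := hfgh.comp (φ := Prod.snd) (ψ := id) measurable_snd measurable_id
  rw [indepFun_iff_map_prod_eq_prod_map_map (by fun_prop) (by fun_prop)] at hfg hfgh hgh ⊢
  have := Measure.isProbabilityMeasure_map (μ := μ) hf.aemeasurable
  have := Measure.isProbabilityMeasure_map (μ := μ) hg.aemeasurable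
  have := Measure.isProbabilityMeasure_map (μ := μ) hh.aemeasurable
  rw [hgh, ← Measure.prodAssoc_prod, ← hfg, ← hfgh, Measure.map_map (by fun_prop) (by fun_prop)]
  rfl

theorem measurable_binThin {α : Type*} [MeasurableSpace α] {c : α → ℕ → ℕ} {y : α → ℕ}
    (hc : Measurable c) (hy : Measurable y) : Measurable fun a => binThin (c a) (y a) := by
  have h : Measurable fun z : (ℕ → ℕ) × ℕ => binThin z.1 z.2 :=
    measurable_from_prod_countable_left fun k =>
      Finset.measurable_sum (Finset.range k) fun s _ => measurable_pi_apply s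
  exact h.comp (hc.prodMk hy)

theorem binThin_mono (c : ℕ → ℕ) : Monotone (binThin c) := fun _ _ h =>
  Finset.sum_le_sum_of_subset (Finset.range_mono h)

/-- Integration of a function of two independent variables, one variable at a time. -/
theorem lintegral_indepFun {α β : Type*} [MeasurableSpace α] [MeasurableSpace β]
    {f : Ω → α} {g : Ω → β} (hf : Measurable f) (hg : Measurable g) (hfg : IndepFun f g μ)
    {F : α × β → ENNReal} (hF : Measurable F) :
    ∫⁻ ω, F (f ω, g ω) ∂μ = ∫⁻ ω', ∫⁻ ω, F (f ω, g ω') ∂μ ∂μ := by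
  have := Measure.isProbabilityMeasure_map (μ := μ) hf.aemeasurable
  have := Measure.isProbabilityMeasure_map (μ := μ) hg.aemeasurable
  rw [← lintegral_map (f := F) hF (hf.prodMk hg),
    (indepFun_iff_map_prod_eq_prod_map_map hf.aemeasurable hg.aemeasurable).1 hfg,
    lintegral_prod_symm _ hF.aemeasurable, lintegral_map hF.lintegral_prod_left' hg]
  refine lintegral_congr fun ω' => ?_
  exact lintegral_map (hF.comp measurable_prodMk_right) hf

variable {c : Ω → ℕ → ℕ} {y : Ω → ℕ} {q : ℝ}

theorem lintegral_binThin (hc : Measurable c) (hcb : ∀ s, IsBernoulli (fun ω => c ω s) q μ)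
    (hy : Measurable y) (hcy : IndepFun c y μ) :
    ∫⁻ ω, (binThin (c ω) (y ω) : ENNReal) ∂μ = ENNReal.ofReal q * ∫⁻ ω, (y ω : ENNReal) ∂μ := by
  have hF : Measurable fun z : (ℕ → ℕ) × ℕ => (binThin z.1 z.2 : ENNReal) :=
    measurable_from_top.comp (measurable_binThin measurable_fst measurable_snd)
  have hcs : ∀ s, Measurable fun ω => c ω s := fun s => (measurable_pi_apply s).comp hc
  rw [lintegral_indepFun hc hy hcy hF,
    ← lintegral_const_mul (f := fun ω => (y ω : ENNReal)) _ (measurable_from_top.comp hy)]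
  refine lintegral_congr fun ω' => ?_
  simp only [binThin, Nat.cast_sum]
  rw [lintegral_finsetSum (f := fun s ω => (c ω s : ENNReal)) _
    fun s _ => measurable_from_top.comp (hcs s)]
  simp only [(hcb _).lintegral_eq (hcs _), Finset.sum_const, Finset.card_range, nsmul_eq_mul]
  rw [mul_comm]

/-- The variance of a binomial variable with `k` trials is at most `k`. -/
theorem lintegral_sq_binThin_sub_le (hq : 0 ≤ q) (hc : Measurable c)
    (hci : iIndepFun (fun s ω => c ω s) μ)
    (hcb : ∀ s, IsBernoulli (fun ω => c ω s) q μ) (k : ℕ) :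
    ∫⁻ ω, ‖(binThin (c ω) k : ℝ) - q * k‖ₑ ^ (2 : ℝ) ∂μ ≤ k := by
  have hcs : ∀ s, Measurable fun ω => c ω s := fun s => (measurable_pi_apply s).comp hc
  have hL : ∀ s, MemLp (fun ω => (c ω s : ℝ)) 2 μ := fun s => (hcb s).memLp (hcs s)
  have hmean : ∫ ω, (∑ s ∈ Finset.range k, fun ω => (c ω s : ℝ)) ω ∂μ = q * k := by
    simp only [Finset.sum_apply]
    rw [integral_finsetSum _ fun s _ => (hL s).integrable one_le_two]
    simp only [(hcb _).integral_eq hq (hcs _), Finset.sum_const, Finset.card_range, nsmul_eq_mul]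
    rw [mul_comm]
  have hvar : variance (∑ s ∈ Finset.range k, fun ω => (c ω s : ℝ)) μ ≤ k := by
    rw [IndepFun.variance_sum (fun s _ => hL s)]
    · calc _ ≤ ∑ s ∈ Finset.range k, (1 : ℝ) :=
            Finset.sum_le_sum fun s _ => (hcb s).variance_le (hcs s)
        _ = k := by simp
    · intro s _ s' _ hss
      exact (hci.indepFun hss).comp (φ := fun x : ℕ => (x : ℝ)) (ψ := fun x : ℕ => (x : ℝ))
        measurable_from_top measurable_from_top
  have hsum : MemLp (∑ s ∈ Finset.range k, fun ω => (c ω s : ℝ)) 2 μ :=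
    memLp_finsetSum' _ fun s _ => hL s
  calc _ = evariance (∑ s ∈ Finset.range k, fun ω => (c ω s : ℝ)) μ := by
        rw [evariance, hmean]
        refine lintegral_congr fun ω => ?_
        simp [binThin]
    _ = ENNReal.ofReal (variance (∑ s ∈ Finset.range k, fun ω => (c ω s : ℝ)) μ) :=
        hsum.ofReal_variance_eq.symm
    _ ≤ k := by
        rw [← ENNReal.ofReal_natCast]
        exact ENNReal.ofReal_le_ofReal hvar

theorem eLpNorm_binThin_sub_le (hq : 0 ≤ q) (hc : Measurable c)
    (hci : iIndepFun (fun s ω => c ω s) μ)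
    (hcb : ∀ s, IsBernoulli (fun ω => c ω s) q μ) (hy : Measurable y) (hcy : IndepFun c y μ) :
    eLpNorm (fun ω => (binThin (c ω) (y ω) : ℝ) - q * y ω) 2 μ
      ≤ (∫⁻ ω, (y ω : ENNReal) ∂μ) ^ (1 / 2 : ℝ) := by
  rw [eLpNorm_eq_lintegral_rpow_enorm_toReal two_ne_zero ENNReal.ofNat_ne_top]
  simp only [ENNReal.toReal_ofNat]
  refine ENNReal.rpow_le_rpow ?_ (by norm_num)
  have hF : Measurable fun z : (ℕ → ℕ) × ℕ => ‖(binThin z.1 z.2 : ℝ) - q * z.2‖ₑ ^ (2 : ℝ) := by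
    have h1 : Measurable fun z : (ℕ → ℕ) × ℕ => (binThin z.1 z.2 : ℝ) :=
      measurable_from_top.comp (measurable_binThin measurable_fst measurable_snd)
    have h2 : Measurable fun z : (ℕ → ℕ) × ℕ => (z.2 : ℝ) :=
      measurable_from_top.comp measurable_snd
    exact ((h1.sub (h2.const_mul q)).enorm).pow_const _
  rw [lintegral_indepFun hc hy hcy hF]
  exact lintegral_mono fun ω' => lintegral_sq_binThin_sub_le hq hc hci hcb (y ω')

/-- The `L²` norm of a thinning is contracted by `q`, up to a term that involves only the first
moment of the thinned variable. -/
theorem eLpNorm_binThin_le (hq : 0 ≤ q) (hc : Measurable c)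
    (hci : iIndepFun (fun s ω => c ω s) μ)
    (hcb : ∀ s, IsBernoulli (fun ω => c ω s) q μ) (hy : Measurable y) (hcy : IndepFun c y μ) :
    eLpNorm (fun ω => (binThin (c ω) (y ω) : ℝ)) 2 μ
      ≤ ENNReal.ofReal q * eLpNorm (fun ω => (y ω : ℝ)) 2 μ
        + (∫⁻ ω, (y ω : ENNReal) ∂μ) ^ (1 / 2 : ℝ) := by
  have h1 : Measurable fun ω => (binThin (c ω) (y ω) : ℝ) :=
    measurable_from_top.comp (measurable_binThin hc hy)
  have h2 : Measurable fun ω => q * (y ω : ℝ) := (measurable_from_top.comp hy).const_mul q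
  have h3 : eLpNorm (fun ω => q * (y ω : ℝ)) 2 μ
      = ENNReal.ofReal q * eLpNorm (fun ω => (y ω : ℝ)) 2 μ := by
    rw [← Real.enorm_of_nonneg hq]
    exact eLpNorm_const_smul q (fun ω => (y ω : ℝ)) 2 μ
  calc eLpNorm (fun ω => (binThin (c ω) (y ω) : ℝ)) 2 μ
      = eLpNorm ((fun ω => q * (y ω : ℝ)) +
          fun ω => (binThin (c ω) (y ω) : ℝ) - q * y ω) 2 μ := by
        congr 1
        ext ω
        simp
    _ ≤ _ := eLpNorm_add_le h2.aestronglyMeasurable (h1.sub h2).aestronglyMeasurable one_le_two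
    _ ≤ _ := by
        rw [h3]
        gcongr
        exact eLpNorm_binThin_sub_le hq hc hci hcb hy hcy

omit [IsProbabilityMeasure μ] in
theorem eLpNorm_natCast_sum_le {ι : Type*} (s : Finset ι) {f : ι → Ω → ℕ}
    (hf : ∀ i, Measurable (f i)) :
    eLpNorm (fun ω => ((∑ i ∈ s, f i ω : ℕ) : ℝ)) 2 μ
      ≤ ∑ i ∈ s, eLpNorm (fun ω => (f i ω : ℝ)) 2 μ := by
  have h : (fun ω => ((∑ i ∈ s, f i ω : ℕ) : ℝ)) = ∑ i ∈ s, fun ω => (f i ω : ℝ) := by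
    ext ω
    simp
  rw [h]
  exact eLpNorm_sum_le
    (fun i _ => (measurable_from_top.comp (hf i) :
      Measurable fun ω => (f i ω : ℝ)).aestronglyMeasurable) one_le_two

omit [IsProbabilityMeasure μ] in
theorem lintegral_natCast_sum {ι : Type*} (s : Finset ι) {f : ι → Ω → ℕ}
    (hf : ∀ i, Measurable (f i)) :
    ∫⁻ ω, ((∑ i ∈ s, f i ω : ℕ) : ENNReal) ∂μ = ∑ i ∈ s, ∫⁻ ω, (f i ω : ENNReal) ∂μ := by
  simp only [Nat.cast_sum]
  exact lintegral_finsetSum _ fun i _ => measurable_from_top.comp (hf i)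

end ThinningMoments

/-! ### The recursion and its iterates from zero -/

section Step

variable {p m n : ℕ}

/-- The right-hand side of the MAT-INAR recursion for the realised noise `N`, as a function of the
states `x l` at lag `l + 1`. -/
def matInarStep (N : Noise p m n) (x : Fin p → Fin m → Fin n → ℕ) (i : Fin m) (j : Fin n) : ℕ :=
  (∑ l, ∑ k, binThin (fun s => N.2.2 (l, i, k, j, s))
    (∑ k', binThin (fun s => N.2.1 (l, i, k', k, s)) (x l k' k))) + N.1 i j

theorem matInarStep_mono (N : Noise p m n) : Monotone (matInarStep N) := fun x x' h i j => by
  unfold matInarStep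
  refine Nat.add_le_add_right (Finset.sum_le_sum fun l _ => Finset.sum_le_sum fun k _ =>
    binThin_mono _ (Finset.sum_le_sum fun k' _ => binThin_mono _ (h l k' k))) _

theorem measurable_matInarStep {α : Type*} [MeasurableSpace α] {N : α → Noise p m n}
    {x : α → Fin p → Fin m → Fin n → ℕ} (hN : Measurable N) (hx : Measurable x) :
    Measurable fun a => matInarStep (N a) (x a) := by
  refine measurable_pi_lambda _ fun i => measurable_pi_lambda _ fun j => ?_
  unfold matInarStep
  refine Measurable.add (Finset.measurable_sum _ fun l _ => Finset.measurable_sum _ fun k _ =>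
    measurable_binThin (by fun_prop) (Finset.measurable_sum _ fun k' _ =>
      measurable_binThin (by fun_prop) (by fun_prop))) (by fun_prop)

/-- The value at time `t` of the `K`-th Picard iterate of the recursion, starting from the path that
is `0` at all times, as a function of the noises `N k` at the times `t - k`. -/
def matInarIter : ℕ → (ℕ → Noise p m n) → Fin m → Fin n → ℕ
  | 0, _ => 0
  | K + 1, N => matInarStep (N 0) fun l => matInarIter K fun k => N (k + (l + 1))

/-- The limit of the increasing sequence `matInarIter K N`. In `ℕ` the supremum of an unbounded
sequence is `0`; the iterates are bounded only almost surely. -/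
noncomputable def matInarLimit (N : ℕ → Noise p m n) (i : Fin m) (j : Fin n) : ℕ :=
  ⨆ K, matInarIter K N i j

theorem matInarIter_le_succ (K : ℕ) (N : ℕ → Noise p m n) :
    matInarIter K N ≤ matInarIter (K + 1) N := by
  induction K generalizing N with
  | zero => exact fun i j => Nat.zero_le _
  | succ K ih => exact matInarStep_mono _ fun l => ih _

theorem monotone_matInarIter (N : ℕ → Noise p m n) : Monotone fun K => matInarIter K N :=
  monotone_nat_of_le_succ fun K => matInarIter_le_succ K N

theorem measurable_matInarIter (K : ℕ) :
    Measurable (matInarIter K : (ℕ → Noise p m n) → Fin m → Fin n → ℕ) := by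
  induction K with
  | zero => exact measurable_const
  | succ K ih =>
    refine measurable_matInarStep (measurable_pi_apply 0) (measurable_pi_lambda _ fun l => ?_)
    exact ih.comp (measurable_pi_lambda _ fun k => measurable_pi_apply _)

theorem measurable_matInarLimit :
    Measurable (matInarLimit : (ℕ → Noise p m n) → Fin m → Fin n → ℕ) := by
  refine measurable_pi_lambda _ fun i => measurable_pi_lambda _ fun j => ?_
  refine Measurable.iSup fun K => ?_
  exact (measurable_pi_apply j).comp ((measurable_pi_apply i).comp (measurable_matInarIter K))

/-- A bounded increasing sequence of natural numbers is eventually constant, so the iterates attain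
their limit. -/
theorem eventually_matInarIter_eq_limit {N : ℕ → Noise p m n}
    (hN : ∀ i j, ⨆ K, (matInarIter K N i j : ENNReal) < ⊤) :
    ∀ᶠ K in Filter.atTop, matInarIter K N = matInarLimit N := by
  have h : ∀ i j, ∀ᶠ K in Filter.atTop, matInarIter K N i j = matInarLimit N i j := by
    intro i j
    have hb : BddAbove (Set.range fun K => matInarIter K N i j) := by
      obtain ⟨M, hM⟩ := ENNReal.exists_nat_gt (hN i j).ne
      refine ⟨M, ?_⟩
      rintro _ ⟨K, rfl⟩
      exact_mod_cast (le_iSup (fun K => (matInarIter K N i j : ENNReal)) K).trans hM.le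
    obtain ⟨K, hK⟩ := Nat.sSup_mem (Set.range_nonempty _) hb
    filter_upwards [Filter.eventually_ge_atTop K] with K' hK'
    exact le_antisymm (le_ciSup hb K') (hK.symm.le.trans (monotone_matInarIter N hK' i j))
  simp only [funext_iff]
  exact Filter.eventually_all.2 fun i => Filter.eventually_all.2 (h i)

theorem matInarLimit_eq_step {N : ℕ → Noise p m n}
    (hN : ∀ i j, ⨆ K, (matInarIter K N i j : ENNReal) < ⊤)
    (hN' : ∀ (l : Fin p) i j,
      ⨆ K, (matInarIter K (fun k => N (k + (l + 1))) i j : ENNReal) < ⊤) :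
    matInarLimit N = matInarStep (N 0) fun l => matInarLimit fun k => N (k + (l + 1)) := by
  have h1 := (Filter.tendsto_add_atTop_nat 1).eventually (eventually_matInarIter_eq_limit hN)
  have h2 := Filter.eventually_all.2 fun l => eventually_matInarIter_eq_limit (hN' l)
  obtain ⟨K, hK1, hK2⟩ := (h1.and h2).exists
  rw [← hK1]
  simp only [matInarIter, hK2]

end Step

/-! ### Moments of one step of the recursion -/

section StepMoments

variable {Ω : Type*} [MeasurableSpace Ω] {μ : Measure Ω} [IsProbabilityMeasure μ] {p m n : ℕ}
  {A : Fin p → Matrix (Fin m) (Fin m) ℝ} {B : Fin p → Matrix (Fin n) (Fin n) ℝ}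
  {Lam : Matrix (Fin m) (Fin n) ℝ}
  {E : ℤ → Ω → Matrix (Fin m) (Fin n) ℕ} {L : ℤ → Ω → LeftCounts p m n}
  {R : ℤ → Ω → RightCounts p m n}

omit [IsProbabilityMeasure μ] in
theorem IsMatInarNoise.indepFun_right_left (h : IsMatInarNoise A B Lam E L R μ) (t : ℤ) :
    IndepFun (R t) (L t) μ := by
  refine indepFun_reindex_of_iIndepFun ?_ (h.indep_counts t) Sum.inr Sum.inl (fun x y => by simp)
  rintro (x | x)
  · exact (measurable_pi_apply x).comp (h.measurable_left t)
  · exact (measurable_pi_apply x).comp (h.measurable_right t)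

theorem IsMatInarNoise.indepFun_right_left_past (h : IsMatInarNoise A B Lam E L R μ) {t : ℤ}
    {γ : Type*} [MeasurableSpace γ] {x : Ω → γ} (hx : Measurable x)
    (hind : IndepFun (noiseAt E L R t) x μ) : IndepFun (R t) (fun ω => (L t ω, x ω)) μ :=
  indepFun_prodMk_right_of_indepFun (h.measurable_right t) (h.measurable_left t) hx
    (h.indepFun_right_left t)
    (hind.comp (φ := fun N : Noise p m n => (N.2.2, N.2.1)) (ψ := id) (by fun_prop) measurable_id)

variable {t : ℤ} {x : Ω → Fin m → Fin n → ℕ}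

omit [IsProbabilityMeasure μ] in
theorem indepFun_leftCounts_of_indepFun_noiseAt
    (hind : IndepFun (noiseAt E L R t) x μ) (l : Fin p) (i k' : Fin m) (k : Fin n) :
    IndepFun (fun ω s => L t ω (l, i, k', k, s)) (fun ω => x ω k' k) μ :=
  hind.comp (φ := fun N : Noise p m n => fun s => N.2.1 (l, i, k', k, s))
    (ψ := fun x : Fin m → Fin n → ℕ => x k' k) (by fun_prop) (by fun_prop)

section Entries

variable (h : IsMatInarNoise A B Lam E L R μ) (hx : Measurable x)
  (hind : IndepFun (noiseAt E L R t) x μ)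
include h hx hind

omit [IsProbabilityMeasure μ] hind in
theorem IsMatInarNoise.measurable_leftThin (l : Fin p) (i k' : Fin m) (k : Fin n) :
    Measurable fun ω => binThin (fun s => L t ω (l, i, k', k, s)) (x ω k' k) := by
  have := h.measurable_left t
  exact measurable_binThin (by fun_prop) (by fun_prop)

/-- The right counting series are independent of what they thin, which depends on the left counting
series of the same time and on the past. -/
theorem IsMatInarNoise.indepFun_rightCounts (l : Fin p) (i : Fin m) (k j : Fin n) :
    IndepFun (fun ω s => R t ω (l, i, k, j, s))
      (fun ω => ∑ k', binThin (fun s => L t ω (l, i, k', k, s)) (x ω k' k)) μ :=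
  (h.indepFun_right_left_past hx hind).comp
    (φ := fun r : RightCounts p m n => fun s => r (l, i, k, j, s))
    (ψ := fun z : LeftCounts p m n × (Fin m → Fin n → ℕ) =>
      ∑ k', binThin (fun s => z.1 (l, i, k', k, s)) (z.2 k' k))
    (by fun_prop) (Finset.measurable_sum _ fun k' _ =>
      measurable_binThin (by fun_prop) (by fun_prop))

theorem IsMatInarNoise.lintegral_leftThin (l : Fin p) (i : Fin m) (k : Fin n) :
    ∫⁻ ω, ((∑ k', binThin (fun s => L t ω (l, i, k', k, s)) (x ω k' k) : ℕ) : ENNReal) ∂μ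
      = ∑ k', ENNReal.ofReal (A l i k') * ∫⁻ ω, (x ω k' k : ENNReal) ∂μ := by
  have hL := h.measurable_left t
  rw [lintegral_natCast_sum _ fun k' => h.measurable_leftThin hx l i k' k]
  refine Finset.sum_congr rfl fun k' _ => ?_
  exact lintegral_binThin (by fun_prop) (fun s => h.left_bernoulli t l i k' k s) (by fun_prop)
    (indepFun_leftCounts_of_indepFun_noiseAt hind l i k' k)

theorem IsMatInarNoise.lintegral_rightThin (l : Fin p) (i : Fin m) (k j : Fin n) :
    ∫⁻ ω, (binThin (fun s => R t ω (l, i, k, j, s))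
        (∑ k', binThin (fun s => L t ω (l, i, k', k, s)) (x ω k' k)) : ENNReal) ∂μ
      = ∑ k', ENNReal.ofReal (B l j k) * (ENNReal.ofReal (A l i k') *
          ∫⁻ ω, (x ω k' k : ENNReal) ∂μ) := by
  have hR := h.measurable_right t
  rw [lintegral_binThin (c := fun ω s => R t ω (l, i, k, j, s)) (by fun_prop)
    (fun s => h.right_bernoulli t l i k j s)
    (Finset.measurable_sum _ fun k' _ => h.measurable_leftThin hx l i k' k)
    (h.indepFun_rightCounts hx hind l i k j), h.lintegral_leftThin hx hind, Finset.mul_sum]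
  rfl

theorem IsMatInarNoise.eLpNorm_leftThin_le (hA : ∀ l i j, 0 ≤ A l i j)
    (l : Fin p) (i : Fin m) (k : Fin n) :
    eLpNorm (fun ω =>
        ((∑ k', binThin (fun s => L t ω (l, i, k', k, s)) (x ω k' k) : ℕ) : ℝ)) 2 μ
      ≤ ∑ k', (ENNReal.ofReal (A l i k') * eLpNorm (fun ω => (x ω k' k : ℝ)) 2 μ
          + (∫⁻ ω, (x ω k' k : ENNReal) ∂μ) ^ (1 / 2 : ℝ)) := by
  have hL := h.measurable_left t
  refine (eLpNorm_natCast_sum_le _ fun k' => h.measurable_leftThin hx l i k' k).trans ?_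
  refine Finset.sum_le_sum fun k' _ => ?_
  refine eLpNorm_binThin_le (c := fun ω s => L t ω (l, i, k', k, s)) (hA l i k') (by fun_prop) ?_
    (fun s => h.left_bernoulli t l i k' k s) (by fun_prop)
    (indepFun_leftCounts_of_indepFun_noiseAt hind l i k' k)
  exact (h.indep_counts t).precomp (g := fun s => Sum.inl (l, i, k', k, s)) fun s s' => by simp

theorem IsMatInarNoise.eLpNorm_rightThin_le (hA : ∀ l i j, 0 ≤ A l i j)
    (hB : ∀ l i j, 0 ≤ B l i j) (l : Fin p) (i : Fin m) (k j : Fin n) :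
    eLpNorm (fun ω => (binThin (fun s => R t ω (l, i, k, j, s))
        (∑ k', binThin (fun s => L t ω (l, i, k', k, s)) (x ω k' k)) : ℝ)) 2 μ
      ≤ ENNReal.ofReal (B l j k) * (∑ k', (ENNReal.ofReal (A l i k') *
            eLpNorm (fun ω => (x ω k' k : ℝ)) 2 μ
          + (∫⁻ ω, (x ω k' k : ENNReal) ∂μ) ^ (1 / 2 : ℝ)))
        + (∑ k', ENNReal.ofReal (A l i k') * ∫⁻ ω, (x ω k' k : ENNReal) ∂μ) ^ (1 / 2 : ℝ) := by
  have hR := h.measurable_right t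
  have hc := (h.indep_counts t).precomp (g := fun s => Sum.inr (l, i, k, j, s))
    fun s s' => by simp
  refine (eLpNorm_binThin_le (c := fun ω s => R t ω (l, i, k, j, s)) (hB l j k) (by fun_prop) hc
    (fun s => h.right_bernoulli t l i k j s)
    (Finset.measurable_sum _ fun k' _ => h.measurable_leftThin hx l i k' k)
    (h.indepFun_rightCounts hx hind l i k j)).trans ?_
  rw [h.lintegral_leftThin hx hind]
  gcongr
  exact h.eLpNorm_leftThin_le hx hind hA l i k

omit [IsProbabilityMeasure μ] hind in
theorem IsMatInarNoise.measurable_rightThin (l : Fin p) (i : Fin m) (k j : Fin n) :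
    Measurable fun ω => binThin (fun s => R t ω (l, i, k, j, s))
        (∑ k', binThin (fun s => L t ω (l, i, k', k, s)) (x ω k' k)) := by
  have := h.measurable_right t
  exact measurable_binThin (by fun_prop)
    (Finset.measurable_sum _ fun k' _ => h.measurable_leftThin hx l i k' k)

end Entries

variable {z : Fin p → Ω → Fin m → Fin n → ℕ}

theorem IsMatInarNoise.lintegral_matInarStep (h : IsMatInarNoise A B Lam E L R μ)
    (hz : ∀ l, Measurable (z l)) (hind : ∀ l, IndepFun (noiseAt E L R t) (z l) μ)
    (i : Fin m) (j : Fin n) :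
    ∫⁻ ω, (matInarStep (noiseAt E L R t ω) (fun l => z l ω) i j : ENNReal) ∂μ
      = (∑ l, ∑ k, ∑ k', ENNReal.ofReal (B l j k) * (ENNReal.ofReal (A l i k') *
          ∫⁻ ω, (z l ω k' k : ENNReal) ∂μ)) + ∫⁻ ω, (E t ω i j : ENNReal) ∂μ := by
  have hE : Measurable fun ω => E t ω i j :=
    (measurable_pi_apply j).comp ((measurable_pi_apply i).comp (h.measurable_innov t))
  simp only [matInarStep, noiseAt, Nat.cast_add]
  rw [lintegral_add_right (g := fun ω => (E t ω i j : ENNReal)) _ (measurable_from_top.comp hE),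
    lintegral_natCast_sum _ fun l => Finset.measurable_sum _ fun k _ =>
      h.measurable_rightThin (hz l) l i k j]
  congr 1
  refine Finset.sum_congr rfl fun l _ => ?_
  rw [lintegral_natCast_sum _ fun k => h.measurable_rightThin (hz l) l i k j]
  exact Finset.sum_congr rfl fun k _ => h.lintegral_rightThin (hz l) (hind l) l i k j

/-- When the first moments of the states are bounded by `D`, one step acts on the `L²` norms of the
entries through the same matrix `∑ l, B l ⊗ A l` as on the means, up to an additive term that
depends on `D` but not on the states. -/
theorem IsMatInarNoise.eLpNorm_matInarStep_le (h : IsMatInarNoise A B Lam E L R μ)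
    (hA : ∀ l i j, 0 ≤ A l i j) (hB : ∀ l i j, 0 ≤ B l i j)
    (hz : ∀ l, Measurable (z l)) (hind : ∀ l, IndepFun (noiseAt E L R t) (z l) μ)
    {D : ENNReal} (hD : ∀ l i j, ∫⁻ ω, (z l ω i j : ENNReal) ∂μ ≤ D)
    (i : Fin m) (j : Fin n) :
    eLpNorm (fun ω => (matInarStep (noiseAt E L R t ω) (fun l => z l ω) i j : ℝ)) 2 μ
      ≤ (∑ l, ∑ k, ∑ k', ENNReal.ofReal (B l j k) * (ENNReal.ofReal (A l i k') *
          eLpNorm (fun ω => (z l ω k' k : ℝ)) 2 μ))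
        + ((∑ l, ∑ k, (ENNReal.ofReal (B l j k) * (∑ _k' : Fin m, D ^ (1 / 2 : ℝ))
            + (∑ k', ENNReal.ofReal (A l i k') * D) ^ (1 / 2 : ℝ)))
          + eLpNorm (fun ω => (E t ω i j : ℝ)) 2 μ) := by
  have hE : Measurable fun ω => E t ω i j :=
    (measurable_pi_apply j).comp ((measurable_pi_apply i).comp (h.measurable_innov t))
  have hsum : Measurable fun ω => ∑ l, ∑ k, binThin (fun s => R t ω (l, i, k, j, s))
      (∑ k', binThin (fun s => L t ω (l, i, k', k, s)) (z l ω k' k)) :=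
    Finset.measurable_sum _ fun l _ => Finset.measurable_sum _ fun k _ =>
      h.measurable_rightThin (hz l) l i k j
  rw [← add_assoc]
  simp only [matInarStep, noiseAt, Nat.cast_add (R := ℝ)]
  refine (eLpNorm_add_le (g := fun ω => (E t ω i j : ℝ))
    (measurable_from_top.comp hsum : Measurable fun ω => ((_ : ℕ) : ℝ)).aestronglyMeasurable
    (measurable_from_top.comp hE : Measurable fun ω => ((_ : ℕ) : ℝ)).aestronglyMeasurable
    one_le_two).trans ?_
  gcongr
  refine (eLpNorm_natCast_sum_le _ fun l => Finset.measurable_sum _ fun k _ =>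
      h.measurable_rightThin (hz l) l i k j).trans ?_
  rw [← Finset.sum_add_distrib]
  refine Finset.sum_le_sum fun l _ => ?_
  refine (eLpNorm_natCast_sum_le _ fun k => h.measurable_rightThin (hz l) l i k j).trans ?_
  rw [← Finset.sum_add_distrib]
  refine Finset.sum_le_sum fun k _ => ?_
  refine (h.eLpNorm_rightThin_le (hz l) (hind l) hA hB l i k j).trans ?_
  rw [← Finset.mul_sum, ← add_assoc, ← mul_add, ← Finset.sum_add_distrib]
  gcongr <;> exact hD l _ _

end StepMoments

/-! ### Uniform moment bounds for the iterates -/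

section Moments

/-- The noise at the times `t, t - 1, t - 2, …`. -/
def pastNoise {Ω : Type*} {p m n : ℕ} (E : ℤ → Ω → Matrix (Fin m) (Fin n) ℕ)
    (L : ℤ → Ω → LeftCounts p m n) (R : ℤ → Ω → RightCounts p m n) (t : ℤ) (ω : Ω) (k : ℕ) :
    Noise p m n :=
  noiseAt E L R (t - k) ω

/-- Dropping the first `l + 1` terms of the past at `t` gives the past at `t - (l + 1)`. -/
theorem pastNoise_add {Ω : Type*} {p m n : ℕ} (E : ℤ → Ω → Matrix (Fin m) (Fin n) ℕ)
    (L : ℤ → Ω → LeftCounts p m n) (R : ℤ → Ω → RightCounts p m n) (t : ℤ) (ω : Ω) (l : ℕ) :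
    (fun k => pastNoise E L R t ω (k + (l + 1))) = pastNoise E L R (t - ((l : ℤ) + 1)) ω := by
  ext1 k
  simp only [pastNoise]
  congr 1
  push_cast
  ring

/-- A comparison principle: `C * u` is a supersolution of the recursive inequality satisfied by
`a`, since `u = 1 + ∑ l, (B l ⊗ A l) u`. -/
theorem le_mul_weight_of_recursion {p m n : ℕ} {A : Fin p → Matrix (Fin m) (Fin m) ℝ}
    {B : Fin p → Matrix (Fin n) (Fin n) ℝ} (hA : ∀ l i j, 0 ≤ A l i j) (hB : ∀ l i j, 0 ≤ B l i j)
    {u : Fin m → Fin n → ℝ} (hu0 : ∀ i j, 0 ≤ u i j)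
    (hu : ∀ i j, u i j = 1 + ∑ l, ∑ k, ∑ k', B l j k * A l i k' * u k' k)
    {a : ℕ → ℤ → Fin m → Fin n → ENNReal} {C : ENNReal} (h0 : ∀ t i j, a 0 t i j = 0)
    (hrec : ∀ K t i j, a (K + 1) t i j ≤ (∑ l, ∑ k, ∑ k', ENNReal.ofReal (B l j k) *
      (ENNReal.ofReal (A l i k') * a K (t - (((l : ℕ) : ℤ) + 1)) k' k)) + C)
    (K : ℕ) (t : ℤ) (i : Fin m) (j : Fin n) : a K t i j ≤ C * ENNReal.ofReal (u i j) := by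
  induction K generalizing t i j with
  | zero => rw [h0]; exact zero_le
  | succ K ih =>
    have hnn : ∀ l k k', 0 ≤ B l j k * A l i k' * u k' k := fun l k k' =>
      mul_nonneg (mul_nonneg (hB l j k) (hA l i k')) (hu0 k' k)
    have hexp : ENNReal.ofReal (u i j) = 1 + ∑ l, ∑ k, ∑ k', ENNReal.ofReal (B l j k) *
        (ENNReal.ofReal (A l i k') * ENNReal.ofReal (u k' k)) := by
      rw [hu i j, ENNReal.ofReal_add zero_le_one (Finset.sum_nonneg fun l _ =>
        Finset.sum_nonneg fun k _ => Finset.sum_nonneg fun k' _ => hnn l k k'), ENNReal.ofReal_one,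
        ENNReal.ofReal_sum_of_nonneg fun l _ =>
          Finset.sum_nonneg fun k _ => Finset.sum_nonneg fun k' _ => hnn l k k']
      congr 1
      refine Finset.sum_congr rfl fun l _ => ?_
      rw [ENNReal.ofReal_sum_of_nonneg fun k _ => Finset.sum_nonneg fun k' _ => hnn l k k']
      refine Finset.sum_congr rfl fun k _ => ?_
      rw [ENNReal.ofReal_sum_of_nonneg fun k' _ => hnn l k k']
      refine Finset.sum_congr rfl fun k' _ => ?_
      rw [ENNReal.ofReal_mul (mul_nonneg (hB l j k) (hA l i k')), ENNReal.ofReal_mul (hB l j k),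
        mul_assoc]
    refine (hrec K t i j).trans ?_
    rw [hexp, mul_add, mul_one, add_comm]
    gcongr
    simp only [Finset.mul_sum]
    refine Finset.sum_le_sum fun l _ => Finset.sum_le_sum fun k _ =>
      Finset.sum_le_sum fun k' _ => ?_
    rw [mul_left_comm C, mul_left_comm C]
    gcongr
    exact ih _ _ _

variable {Ω : Type*} [MeasurableSpace Ω] {μ : Measure Ω} {p m n : ℕ}
  {A : Fin p → Matrix (Fin m) (Fin m) ℝ} {B : Fin p → Matrix (Fin n) (Fin n) ℝ}
  {Lam : Matrix (Fin m) (Fin n) ℝ}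
  {E : ℤ → Ω → Matrix (Fin m) (Fin n) ℕ} {L : ℤ → Ω → LeftCounts p m n}
  {R : ℤ → Ω → RightCounts p m n}

theorem IsMatInarNoise.measurable_pastNoise (h : IsMatInarNoise A B Lam E L R μ) (t : ℤ) :
    Measurable (pastNoise E L R t) :=
  measurable_pi_lambda _ fun _ => h.measurable _

theorem IsMatInarNoise.indepFun_pastNoise (h : IsMatInarNoise A B Lam E L R μ) (t : ℤ) :
    IndepFun (noiseAt E L R t) (pastNoise E L R (t - 1)) μ :=
  (indepFun_reindex_of_iIndepFun h.measurable h.indep_time (fun _ : Unit => t)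
    (fun k : ℕ => t - 1 - k) (fun _ k => by omega)).comp 
    (φ := fun x : Unit → Noise p m n => x ()) (ψ := id) (measurable_pi_apply ()) measurable_id

theorem IsMatInarNoise.indepFun_comp_pastNoise (h : IsMatInarNoise A B Lam E L R μ) (t : ℤ)
    {γ : Type*} [MeasurableSpace γ] {f : (ℕ → Noise p m n) → γ} (hf : Measurable f) (l : ℕ) :
    IndepFun (noiseAt E L R t) (fun ω => f (pastNoise E L R (t - ((l : ℤ) + 1)) ω)) μ := by
  have h1 := (h.indepFun_pastNoise t).comp (φ := id)
    (ψ := fun N : ℕ → Noise p m n => f fun k => N (k + l)) measurable_id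
    (hf.comp (measurable_pi_lambda _ fun k => measurable_pi_apply _))
  convert! h1 using 1
  ext1 ω
  simp only [Function.comp]
  congr 1
  ext1 k
  simp only [pastNoise]
  congr 1
  push_cast
  ring

theorem IsMatInarNoise.measurable_matInarIter_pastNoise
    (h : IsMatInarNoise A B Lam E L R μ) (K : ℕ) (t : ℤ)
    (i : Fin m) (j : Fin n) : Measurable fun ω => matInarIter K (pastNoise E L R t ω) i j :=
  (measurable_pi_apply j).comp ((measurable_pi_apply i).comp
    ((measurable_matInarIter K).comp (h.measurable_pastNoise t)))

omit [MeasurableSpace Ω] in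
theorem matInarIter_succ_pastNoise (K : ℕ) (t : ℤ) (ω : Ω) :
    matInarIter (K + 1) (pastNoise E L R t ω) = matInarStep (noiseAt E L R t ω)
      fun l => matInarIter K (pastNoise E L R (t - (((l : ℕ) : ℤ) + 1)) ω) := by
  simp only [matInarIter, pastNoise_add]
  simp [pastNoise]

variable [IsProbabilityMeasure μ]

omit [IsProbabilityMeasure μ] in
theorem IsMatInarNoise.lintegral_innov_eq (h : IsMatInarNoise A B Lam E L R μ) (t : ℤ)
    (i : Fin m) (j : Fin n) :
    ∫⁻ ω, (E t ω i j : ENNReal) ∂μ = ∫⁻ ω, (E 0 ω i j : ENNReal) ∂μ :=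
  ((h.innov_ident t).comp (u := fun e : Fin m → Fin n → ℕ => (e i j : ENNReal))
    (measurable_from_top.comp (by fun_prop : Measurable fun e : Fin m → Fin n → ℕ => e i j)))
    |>.lintegral_eq

omit [IsProbabilityMeasure μ] in
theorem IsMatInarNoise.eLpNorm_innov_eq (h : IsMatInarNoise A B Lam E L R μ) (t : ℤ)
    (i : Fin m) (j : Fin n) :
    eLpNorm (fun ω => (E t ω i j : ℝ)) 2 μ = eLpNorm (fun ω => (E 0 ω i j : ℝ)) 2 μ :=
  ((h.innov_ident t).comp (u := fun e : Fin m → Fin n → ℕ => (e i j : ℝ))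
    (measurable_from_top.comp (by fun_prop : Measurable fun e : Fin m → Fin n → ℕ => e i j)))
    |>.eLpNorm_eq 2

theorem IsMatInarNoise.lintegral_innov_ne_top (h : IsMatInarNoise A B Lam E L R μ) (t : ℤ)
    (i : Fin m) (j : Fin n) : ∫⁻ ω, (E t ω i j : ENNReal) ∂μ ≠ ⊤ := by
  have h1 := ((h.innov_memLp t i j).integrable one_le_two).hasFiniteIntegral
  simp only [HasFiniteIntegral, Real.enorm_natCast] at h1
  exact h1.ne

theorem IsMatInarNoise.exists_lintegral_matInarIter_le (h : IsMatInarNoise A B Lam E L R μ)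
    (hA : ∀ l i j, 0 ≤ A l i j) (hB : ∀ l i j, 0 ≤ B l i j)
    (hρ : spectralRadius ℂ ((companionMatrix A B).map (algebraMap ℝ ℂ)) < 1) :
    ∃ D : ENNReal, D ≠ ⊤ ∧
      ∀ K t i j, ∫⁻ ω, (matInarIter K (pastNoise E L R t ω) i j : ENNReal) ∂μ ≤ D := by
  obtain ⟨u, hu0, hu⟩ := exists_subinvariant_weight hA hB hρ
  set C : ENNReal := ∑ i, ∑ j, ∫⁻ ω, (E 0 ω i j : ENNReal) ∂μ with hC
  have hCtop : C ≠ ⊤ := ENNReal.sum_ne_top.2 fun i _ => ENNReal.sum_ne_top.2 fun j _ =>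
    h.lintegral_innov_ne_top 0 i j
  have key := le_mul_weight_of_recursion hA hB hu0 hu (C := C)
    (a := fun K t i j => ∫⁻ ω, (matInarIter K (pastNoise E L R t ω) i j : ENNReal) ∂μ)
    (fun t i j => by simp [matInarIter]) (fun K t i j => by
      simp only [matInarIter_succ_pastNoise]
      rw [h.lintegral_matInarStep
        (z := fun l ω => matInarIter K (pastNoise E L R (t - (((l : ℕ) : ℤ) + 1)) ω))
        (fun l => (measurable_matInarIter K).comp (h.measurable_pastNoise _))
        (fun l => h.indepFun_comp_pastNoise t (measurable_matInarIter K) l),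
        h.lintegral_innov_eq t]
      gcongr
      exact (Finset.single_le_sum (f := fun j => ∫⁻ ω, (E 0 ω i j : ENNReal) ∂μ)
        (fun _ _ => zero_le) (Finset.mem_univ j)).trans
          (Finset.single_le_sum (f := fun i => ∑ j, ∫⁻ ω, (E 0 ω i j : ENNReal) ∂μ)
            (fun _ _ => zero_le) (Finset.mem_univ i)))
  refine ⟨∑ i, ∑ j, C * ENNReal.ofReal (u i j), ENNReal.sum_ne_top.2 fun i _ =>
    ENNReal.sum_ne_top.2 fun j _ => ENNReal.mul_ne_top hCtop ENNReal.ofReal_ne_top,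
    fun K t i j => (key K t i j).trans ?_⟩
  exact (Finset.single_le_sum (f := fun j => C * ENNReal.ofReal (u i j))
    (fun _ _ => zero_le) (Finset.mem_univ j)).trans
      (Finset.single_le_sum (f := fun i => ∑ j, C * ENNReal.ofReal (u i j))
        (fun _ _ => zero_le) (Finset.mem_univ i))

/-- The bound on the means makes the additive term in the recursion for the `L²` norms uniform in
the number of iterations. -/
theorem IsMatInarNoise.exists_eLpNorm_matInarIter_le (h : IsMatInarNoise A B Lam E L R μ)
    (hA : ∀ l i j, 0 ≤ A l i j) (hB : ∀ l i j, 0 ≤ B l i j)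
    (hρ : spectralRadius ℂ ((companionMatrix A B).map (algebraMap ℝ ℂ)) < 1)
    (i : Fin m) (j : Fin n) :
    ∃ D : ENNReal, D ≠ ⊤ ∧
      ∀ K t, eLpNorm (fun ω => (matInarIter K (pastNoise E L R t ω) i j : ℝ)) 2 μ ≤ D := by
  obtain ⟨D, hDtop, hD⟩ := h.exists_lintegral_matInarIter_le hA hB hρ
  obtain ⟨u, hu0, hu⟩ := exists_subinvariant_weight hA hB hρ
  let c : Fin m → Fin n → ENNReal := fun i j =>
    (∑ l, ∑ k, (ENNReal.ofReal (B l j k) * (∑ _k' : Fin m, D ^ (1 / 2 : ℝ))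
      + (∑ k', ENNReal.ofReal (A l i k') * D) ^ (1 / 2 : ℝ)))
      + eLpNorm (fun ω => (E 0 ω i j : ℝ)) 2 μ
  have hDhalf : D ^ (1 / 2 : ℝ) ≠ ⊤ := ENNReal.rpow_ne_top_of_nonneg (by norm_num) hDtop
  have hc : ∀ i j, c i j ≠ ⊤ := fun i j => by
    refine ENNReal.add_ne_top.2 ⟨ENNReal.sum_ne_top.2 fun l _ => ENNReal.sum_ne_top.2 fun k _ =>
      ENNReal.add_ne_top.2 ⟨ENNReal.mul_ne_top ENNReal.ofReal_ne_top
        (ENNReal.sum_ne_top.2 fun _ _ => hDhalf),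
        ENNReal.rpow_ne_top_of_nonneg (by norm_num) (ENNReal.sum_ne_top.2 fun _ _ =>
          ENNReal.mul_ne_top ENNReal.ofReal_ne_top hDtop)⟩, (h.innov_memLp 0 i j).eLpNorm_ne_top⟩
  have hCtop : ∑ i, ∑ j, c i j ≠ ⊤ := ENNReal.sum_ne_top.2 fun i _ => ENNReal.sum_ne_top.2
    fun j _ => hc i j
  have key := le_mul_weight_of_recursion hA hB hu0 hu (C := ∑ i, ∑ j, c i j)
    (a := fun K t i j => eLpNorm (fun ω => (matInarIter K (pastNoise E L R t ω) i j : ℝ)) 2 μ)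
    (fun t i j => by simp [matInarIter]) (fun K t i j => by
      simp only [matInarIter_succ_pastNoise]
      refine (h.eLpNorm_matInarStep_le hA hB
        (z := fun l ω => matInarIter K (pastNoise E L R (t - (((l : ℕ) : ℤ) + 1)) ω))
        (fun l => (measurable_matInarIter K).comp (h.measurable_pastNoise _))
        (fun l => h.indepFun_comp_pastNoise t (measurable_matInarIter K) l)
        (fun l i j => hD K _ i j) i j).trans ?_
      rw [h.eLpNorm_innov_eq t]
      gcongr
      exact (Finset.single_le_sum (f := fun j => c i j)
        (fun _ _ => zero_le) (Finset.mem_univ j)).trans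
          (Finset.single_le_sum (f := fun i => ∑ j, c i j)
            (fun _ _ => zero_le) (Finset.mem_univ i)))
  exact ⟨_, ENNReal.mul_ne_top hCtop ENNReal.ofReal_ne_top, fun K t => key K t i j⟩

theorem IsMatInarNoise.ae_iSup_matInarIter_lt_top (h : IsMatInarNoise A B Lam E L R μ)
    (hA : ∀ l i j, 0 ≤ A l i j) (hB : ∀ l i j, 0 ≤ B l i j)
    (hρ : spectralRadius ℂ ((companionMatrix A B).map (algebraMap ℝ ℂ)) < 1) :
    ∀ᵐ ω ∂μ, ∀ t i j, ⨆ K, (matInarIter K (pastNoise E L R t ω) i j : ENNReal) < ⊤ := by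
  obtain ⟨D, hDtop, hD⟩ := h.exists_lintegral_matInarIter_le hA hB hρ
  simp only [ae_all_iff]
  intro t i j
  have hm : ∀ K, Measurable fun ω => (matInarIter K (pastNoise E L R t ω) i j : ENNReal) :=
    fun K => measurable_from_top.comp (h.measurable_matInarIter_pastNoise K t i j)
  refine ae_lt_top (Measurable.iSup hm) ?_
  rw [lintegral_iSup hm fun K K' hK ω => by
    exact_mod_cast monotone_matInarIter (pastNoise E L R t ω) hK i j]
  exact ((iSup_le fun K => hD K t i j).trans_lt hDtop.lt_top).ne

/-- Fatou's lemma carries the uniform `L²` bound over to the limit. -/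
theorem IsMatInarNoise.memLp_matInarLimit (h : IsMatInarNoise A B Lam E L R μ)
    (hA : ∀ l i j, 0 ≤ A l i j) (hB : ∀ l i j, 0 ≤ B l i j)
    (hρ : spectralRadius ℂ ((companionMatrix A B).map (algebraMap ℝ ℂ)) < 1)
    (t : ℤ) (i : Fin m) (j : Fin n) :
    MemLp (fun ω => (matInarLimit (pastNoise E L R t ω) i j : ℝ)) 2 μ := by
  obtain ⟨D, hDtop, hD⟩ := h.exists_eLpNorm_matInarIter_le hA hB hρ i j
  have hY : Measurable fun ω => matInarLimit (pastNoise E L R t ω) i j :=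
    (measurable_pi_apply j).comp ((measurable_pi_apply i).comp
      (measurable_matInarLimit.comp (h.measurable_pastNoise t)))
  have hm : ∀ K, Measurable fun ω => (matInarIter K (pastNoise E L R t ω) i j : ℝ) :=
    fun K => measurable_from_top.comp (h.measurable_matInarIter_pastNoise K t i j)
  refine ⟨(measurable_from_top.comp hY : Measurable fun ω => ((_ : ℕ) : ℝ)).aestronglyMeasurable,
    ?_⟩
  refine (Lp.eLpNorm_lim_le_liminf_eLpNorm (p := 2)
    (f := fun K ω => (matInarIter K (pastNoise E L R t ω) i j : ℝ))
    (fun K => (hm K).aestronglyMeasurable) _ ?_).trans_lt (lt_of_le_of_lt ?_ hDtop.lt_top)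
  · filter_upwards [h.ae_iSup_matInarIter_lt_top hA hB hρ] with ω hω
    refine tendsto_const_nhds.congr' ?_
    filter_upwards [eventually_matInarIter_eq_limit (hω t)] with K hK
    rw [hK]
  · exact Filter.liminf_le_of_frequently_le' (Filter.Frequently.of_forall fun K => hD K t)

end Moments

/-! ### The stationary solution -/

theorem proposition1 {Ω : Type*} [MeasurableSpace Ω] (μ : Measure Ω) [IsProbabilityMeasure μ]
    (p m n : ℕ)
    (A : Fin p → Matrix (Fin m) (Fin m) ℝ) (B : Fin p → Matrix (Fin n) (Fin n) ℝ)
    (hA : ∀ l i j, A l i j ∈ Set.Icc (0 : ℝ) 1) (hB : ∀ l i j, B l i j ∈ Set.Icc (0 : ℝ) 1)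
    (Lam : Matrix (Fin m) (Fin n) ℝ)
    (E : ℤ → Ω → Matrix (Fin m) (Fin n) ℕ) (L : ℤ → Ω → LeftCounts p m n)
    (R : ℤ → Ω → RightCounts p m n) (hnoise : IsMatInarNoise A B Lam E L R μ)
    (hρ : spectralRadius ℂ ((companionMatrix A B).map (algebraMap ℝ ℂ)) < 1) :
    ∃ Y : ℤ → Ω → Matrix (Fin m) (Fin n) ℕ,
      IsMatInar E L R Y μ ∧
      IsStrictlyStationary Y μ ∧
      IsErgodicProcess Y μ ∧
      (∀ t i j, MemLp (fun ω => (Y t ω i j : ℝ)) 2 μ) ∧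
      IsCausal E L R Y μ := by
  have hA0 : ∀ l i j, 0 ≤ A l i j := fun l i j => (hA l i j).1
  have hB0 : ∀ l i j, 0 ≤ B l i j := fun l i j => (hB l i j).1
  let Y : ℤ → Ω → Matrix (Fin m) (Fin n) ℕ := fun t ω => matInarLimit (pastNoise E L R t ω)
  let noisePath : Ω → ℤ → Noise p m n := fun ω t => noiseAt E L R t ω
  -- `Y` is a factor of the i.i.d. noise: `G` maps the noise path to the path of `Y` and commutes
  -- with the shifts, so it transports stationarity and ergodicity.
  let G : (ℤ → Noise p m n) → ℤ → Fin m → Fin n → ℕ := fun N t =>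
    matInarLimit fun k : ℕ => N (t - k)
  have hG : Measurable G := measurable_pi_lambda _ fun t =>
    measurable_matInarLimit.comp (measurable_pi_lambda _ fun k => measurable_pi_apply _)
  have hpath : Measurable noisePath := measurable_pi_lambda _ hnoise.measurable
  have hsample : samplePath Y = G ∘ noisePath := rfl
  have hcomm : ∀ h : ℤ, shiftPath h ∘ G = G ∘ shiftPath h := by
    intro h
    ext N t i j
    simp only [Function.comp, shiftPath, G]
    congr 1
    ext1 k
    congr 1
    ring
  have hmapY : μ.map (samplePath Y) = (μ.map noisePath).map G := by
    rw [hsample, Measure.map_map hG hpath]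
  have hGpres : MeasurePreserving G (μ.map noisePath) (μ.map (samplePath Y)) := ⟨hG, hmapY.symm⟩
  refine ⟨Y, ⟨fun t => ?_, fun t => ?_, fun t => ?_⟩, fun h => ?_, ?_,
    hnoise.memLp_matInarLimit hA0 hB0 hρ, matInarLimit, measurable_matInarLimit,
    fun t => Filter.Eventually.of_forall fun ω => rfl⟩
  · exact measurable_matInarLimit.comp (hnoise.measurable_pastNoise t)
  · filter_upwards [hnoise.ae_iSup_matInarIter_lt_top hA0 hB0 hρ] with ω hω
    have h1 := matInarLimit_eq_step (hω t) fun l i j => by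
      simpa only [pastNoise_add] using hω (t - (((l : ℕ) : ℤ) + 1)) i j
    simp only [pastNoise_add] at h1
    have h0 : pastNoise E L R t ω 0 = noiseAt E L R t ω := by simp [pastNoise]
    rw [h0] at h1
    ext i j
    simp only [Matrix.add_apply, Matrix.sum_apply, rightThin, leftThin, Matrix.of_apply]
    exact congrFun (congrFun h1 i) j
  · have h1 := hnoise.indepFun_comp_pastNoise t (l := 0)
      (f := fun (N : ℕ → Noise p m n) (s : ℕ) => matInarLimit fun k => N (k + s))
      (measurable_pi_lambda _ fun s => measurable_matInarLimit.comp
        (measurable_pi_lambda _ fun k => measurable_pi_apply _))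
    convert! h1 using 1
    ext1 ω
    ext1 s
    simp only [Y]
    change matInarLimit _ = matInarLimit _
    congr 1
    ext1 k
    simp only [pastNoise]
    congr 1
    push_cast
    ring
  · have h1 : (fun ω => shiftPath h (samplePath Y ω)) =
        G ∘ fun ω => shiftPath h (noisePath ω) := by
      ext1 ω
      exact congrFun (hcomm h) (noisePath ω)
    have h2 : Measurable fun ω => shiftPath h (noisePath ω) := (measurable_shiftPath h).comp hpath
    rw [h1, hmapY, ← Measure.map_map hG h2,
      map_shiftPath_of_iid hnoise.measurable hnoise.indep_time hnoise.map_noiseAt h]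
  · exact hGpres.ergodic_of_ergodic_semiconj
      (ergodic_shiftPath_of_iid hnoise.measurable hnoise.indep_time hnoise.map_noiseAt)
      (measurable_shiftPath 1) (fun N => (congrFun (hcomm 1) N).symm)
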